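/- Let $r\ge 3$, $0\le a\le r-2$ and $1\le j\le r-1$ be integers. Let $U_n(w,t)$, $V_n(w,t)$ be the Lucas polynomials: $U_0=0$, $U_1=1$, $V_0=2$, $V_1=w$, and both satisfy $X_n=wX_{n-1}-tX_{n-2}$. Here $t$ ranges over the Riemann surface of the logarithm, i.e. $t\neq0$ comes with a choice of $\log t\in\mathbb C$ and $t^s:=e^{s\log t}$. Put $f(w)=\frac1r V_r(w,t)$; it has a critical point at $w_j=2\sqrt t\cos(j\pi/r)$. A *flow line* is a solution of $\frac{dz}{d\tau}=-\overline{f'(z)}$ on its maximal interval of existence $(-\infty,T)$, $T\le+\infty$. A flow line that starts at $w_j$ at $\tau=-\infty$ and ends at another critical point at $\tau=+\infty$ is called a *Stokes line*; $t$ lies on a *Stokes ray* for $j$ if such a line exists. Otherwise $w_j$ together with the two flow lines emanating from it is the *Lefschetz thimble* $\hat C_j$, which we orient so that its tangent vector at $w_j$ is a positive multiple of $\sqrt{(-1)^j}\,t^{(2-r)/4}$, where $\sqrt{(-1)^j}$ is $\mathrm i$ for $j$ odd and $1$ for $j$ even. The Airy–Lucas function is $$\widehat{\mathrm{Ai}}{}^{\,j}_{r,a}(t)=\frac{1}{2\pi\sqrt{(-1)^j}}\int_{\hat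 C_j}U_{a+1}(w,t)\,e^{\frac1rV_r(w,t)}\,dw .$$ Let $\mathsf B_{r,a}(u)$ be the formal hypergeometric series $$\mathsf B_{r,a}(u)=\sum_{m\ge0}\left(\prod_{k=1}^m\frac{\bigl((2k-1)r-2(a+1)\bigr)\bigl((2k-1)r+2(a+1)\bigr)}{k}\right)\left(-\frac{u}{16r^2}\right)^m=\sum_{m\ge 0}\beta_m u^m .$$ **Proposition.** (i) For every $t$ not on a Stokes ray for $j$, the oriented thimble $\hat C_j$ exists, the integral converges absolutely, and its value does not depend on the parametrisation of the thimble. (ii) As $t\to\infty$ away from the Stokes rays, $$\widehat{\mathrm{Ai}}{}^{\,j}_{r,a}(t)\sim\frac{e^{(-1)^j\frac2r t^{r/2}}}{\sqrt{\pi r}}\,\sin\!\left(\frac{(a+1)j\pi}{r}\right)t^{(2a+2-r)/4}\,\mathsf B_{r,a}\!\left((-1)^{j+1}r\,t^{-r/2}\right).$$ That is, for every closed sector $\alpha\le\arg t\le\beta$ containing no Stokes ray for $j$ and every $N\ge0$ there are constants $C,R$ such that, for all $t$ in the sector with $|t|\ge R$, $$\left|\widehat{\mathrm{Ai}}{}^{\,j}_{r,a}(t)-\frac{e^{(-1)^j\frac2r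 t^{r/2}}}{\sqrt{\pi r}}\sin\!\left(\frac{(a+1)j\pi}{r}\right)t^{(2a+2-r)/4}\sum_{m=0}^{N-1}\beta_m\bigl((-1)^{j+1}r\,t^{-r/2}\bigr)^m\right|\le C\left|e^{(-1)^j\frac2r t^{r/2}}\,t^{(2a+2-r)/4}\right|\,\bigl|t^{-r/2}\bigr|^N .$$ -/

import Mathlib

open Filter Topology MeasureTheory
open scoped ComplexConjugate

noncomputable section

namespace AiryLucas

/-- Lucas polynomials of the first kind:
`U_0 = 0`, `U_1 = 1`, `U_n(w,t) = w U_{n-1}(w,t) - t U_{n-2}(w,t)`. -/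
def lucasU : ℕ → ℂ → ℂ → ℂ
  | 0, _, _ => 0
  | 1, _, _ => 1
  | n + 2, w, t => w * lucasU (n + 1) w t - t * lucasU n w t

/-- Lucas polynomials of the second kind:
`V_0 = 2`, `V_1 = w`, `V_n(w,t) = w V_{n-1}(w,t) - t V_{n-2}(w,t)`. -/
def lucasV : ℕ → ℂ → ℂ → ℂ
  | 0, _, _ => 2
  | 1, w, _ => w
  | n + 2, w, t => w * lucasV (n + 1) w t - t * lucasV n w t

/-! ### Steepest descent flow and Lefschetz thimbles -/

/-- `z` solves the steepest descent equation `dz/dτ = - ∂(conj f)/∂(conj z) = - conj (f'(z))`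
on the time interval `(-∞, T)`. (Solutions may blow up in finite time, so `T = ∞` is not
imposed.) -/
def IsFlowLine (f : ℂ → ℂ) (T : EReal) (z : ℝ → ℂ) : Prop :=
  ∀ τ : ℝ, (τ : EReal) < T → HasDerivAt z (-conj (deriv f (z τ))) τ

/-- There is a Stokes line starting at `p`: a flow line that starts at `p` at time `-∞` and
ends at another critical point `q ≠ p` at time `+∞`. -/
def HasStokesLine (f : ℂ → ℂ) (p : ℂ) : Prop :=
  ∃ (q : ℂ) (z : ℝ → ℂ), q ≠ p ∧ deriv f q = 0 ∧ IsFlowLine f ⊤ z ∧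
    Tendsto z atBot (𝓝 p) ∧ Tendsto z atTop (𝓝 q)

/-- `z`, on its maximal interval of existence `(-∞, T)`, is a flow line which starts at `p` at
time `-∞`, leaves `p` in the direction of the unit vector `e`, and is not a Stokes line. -/
structure IsHalfThimble (f : ℂ → ℂ) (p e : ℂ) (T : EReal) (z : ℝ → ℂ) : Prop where
  bot_lt : ⊥ < T
  flow : IsFlowLine f T z
  maximal : ∀ (T' : EReal) (z' : ℝ → ℂ), T < T' → IsFlowLine f T' z' →
    ¬ Set.EqOn z' z {τ : ℝ | (τ : EReal) < T}
  tendsto_start : Tendsto z atBot (𝓝 p)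
  direction : Tendsto (fun τ => (z τ - p) / (‖z τ - p‖ : ℂ)) atBot (𝓝 e)
  not_stokes : ¬ (T = ⊤ ∧ ∃ q : ℂ, q ≠ p ∧ deriv f q = 0 ∧ Tendsto z atTop (𝓝 q))

/-- A parametrised Lefschetz thimble of `f` through the critical point `p`, oriented so that its
unit tangent vector at `p` is `e`. It consists of `p` and the two flow lines emanating from `p`:
the incoming half leaves `p` in the direction `-e` and the outgoing half in the direction `e`. -/
structure LefschetzThimble (f : ℂ → ℂ) (p e : ℂ) where
  /-- end of the time interval of the incoming half -/
  Tin : EReal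
  /-- end of the time interval of the outgoing half -/
  Tout : EReal
  /-- the incoming half, parametrised by the flow (away from `p`) -/
  zin : ℝ → ℂ
  /-- the outgoing half, parametrised by the flow (away from `p`) -/
  zout : ℝ → ℂ
  isHalf_in : IsHalfThimble f p (-e) Tin zin
  isHalf_out : IsHalfThimble f p e Tout zout

namespace LefschetzThimble

variable {f : ℂ → ℂ} {p e : ℂ}

/-- The contour integral of `F(w) dw` over the thimble converges absolutely. -/
def Converges (Γ : LefschetzThimble f p e) (F : ℂ → ℂ) : Prop :=
  IntegrableOn (fun τ => F (Γ.zin τ) * deriv Γ.zin τ) {τ : ℝ | (τ : EReal) < Γ.Tin} ∧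
  IntegrableOn (fun τ => F (Γ.zout τ) * deriv Γ.zout τ) {τ : ℝ | (τ : EReal) < Γ.Tout}

/-- The contour integral of `F(w) dw` over the oriented thimble: along the outgoing half, minus
along the incoming half (whose flow parametrisation runs against the orientation). -/
def integral (Γ : LefschetzThimble f p e) (F : ℂ → ℂ) : ℂ :=
  (∫ τ in {τ : ℝ | (τ : EReal) < Γ.Tout}, F (Γ.zout τ) * deriv Γ.zout τ) -
  (∫ τ in {τ : ℝ | (τ : EReal) < Γ.Tin}, F (Γ.zin τ) * deriv Γ.zin τ)

end LefschetzThimble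

/-! ### Airy-Lucas functions

Fractional powers of `t` are taken on the Riemann surface of the logarithm. A point of it is
recorded by its logarithm `ℓ`: it lies over `t = exp ℓ`, and has modulus `|t| = exp (Re ℓ)` and
argument `Im ℓ`. -/

/-- The power `t ^ s` at the point over `t = exp ℓ` of the Riemann surface of the logarithm. -/
def tpow (ℓ s : ℂ) : ℂ := Complex.exp (s * ℓ)

/-- The square root of `(-1)^j`: it is `i` for odd `j` and `1` for even `j`. -/
def sqrtSign (j : ℕ) : ℂ := if Odd j then Complex.I else 1

/-- The phase function `w ↦ V_r(w,t) / r`. -/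
def phase (r : ℕ) (ℓ : ℂ) (w : ℂ) : ℂ := lucasV r w (Complex.exp ℓ) / r

/-- The integrand `U_{a+1}(w,t) exp (V_r(w,t) / r)`. -/
def integrand (r a : ℕ) (ℓ : ℂ) (w : ℂ) : ℂ :=
  lucasU (a + 1) w (Complex.exp ℓ) * Complex.exp (phase r ℓ w)

/-- The critical point `w_j = 2 √t cos (jπ/r)` of the phase function. -/
def critPt (r j : ℕ) (ℓ : ℂ) : ℂ :=
  2 * tpow ℓ (1 / 2) * (Real.cos (j * Real.pi / r) : ℂ)

/-- The unit tangent vector at `w_j` of the oriented thimble: the phase of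
`√((-1)^j) t^{(2-r)/4}`. -/
def orientation (r j : ℕ) (ℓ : ℂ) : ℂ :=
  sqrtSign j * (tpow ℓ ((2 - r) / 4) / (‖tpow ℓ ((2 - r) / 4)‖ : ℂ))

/-- Lefschetz thimbles of `V_r(·,t)/r` through `w_j`. -/
abbrev Thimble (r j : ℕ) (ℓ : ℂ) : Type :=
  LefschetzThimble (phase r ℓ) (critPt r j ℓ) (orientation r j ℓ)

/-- The point over `t = exp ℓ` lies on a Stokes ray for the index `j`: there is a Stokes line
starting at `w_j`. -/
def OnStokesRay (r j : ℕ) (ℓ : ℂ) : Prop := HasStokesLine (phase r ℓ) (critPt r j ℓ)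

open Classical in
/-- The Airy-Lucas function: `1 / (2π √((-1)^j))` times the integral of
`U_{a+1}(w,t) exp (V_r(w,t)/r) dw` over the Lefschetz thimble through `w_j`
(and `0` where there is no thimble, on the Stokes rays). -/
def Ai (r a j : ℕ) (ℓ : ℂ) : ℂ :=
  if h : Nonempty (Thimble r j ℓ) then
    1 / (2 * Real.pi * sqrtSign j) * (Classical.choice h).integral (integrand r a ℓ)
  else 0

/-- The (formal, divergent) hypergeometric series
`B_{r,a}(u) = ∑_m (∏_{k=1}^m ((2k-1)r - 2(a+1)) ((2k-1)r + 2(a+1)) / k) (-u / (16 r²))^m`. -/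
def B (r a : ℕ) : PowerSeries ℂ :=
  PowerSeries.mk fun m =>
    (∏ k ∈ Finset.Icc 1 m,
      ((2 * (k : ℂ) - 1) * r - 2 * (a + 1)) * ((2 * (k : ℂ) - 1) * r + 2 * (a + 1)) / k) *
    (-1 / (16 * (r : ℂ) ^ 2)) ^ m

end AiryLucas

end

/-! Write w = 2√t cosh s. Then V_r(w,t) = 2 t^{r/2} cosh(rs) and U_{a+1}(w,t) sinh s = t^{a/2}
sinh((a+1)s), and w_j is the point s = ijπ/r. Put s = ijπ/r + (2/r) arsinh(vy) with 4v² = (-1)^{j+1}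
r t^{-r/2}. Since cosh(2 arsinh x) = 1 + 2x², the phase becomes exactly f(w_j) - y²
(`phase_thimbleCurve`), so the thimble is, in closed form, the image of the real y-axis, provided
that the line vℝ avoids the cuts of arsinh on the imaginary axis, i.e. Re v ≠ 0. If Re v = 0, then
(-1)^j t^{r/2} > 0 and the arc of angles from jπ/r to a neighbouring (j±1)π/r gives an explicit
Stokes line (`hasStokesLine_of_pos`). Hence Re v ≠ 0 off the Stokes rays.

A thimble is by definition any pair of maximal flow lines with prescribed initial directions, so
uniqueness is needed too. Along such a line f stays in f(w_j) - [0,∞), and the closed-form curve γ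
is locally biholomorphic at 0; near w_j the line therefore lies on γ at a real parameter ±D, and the
direction fixes the sign. Uniqueness for the flow and maximality then identify the whole line with
half of γ up to a change of time (`exists_timeChange_of_isHalfThimble`). All thimble integrals
become integrals over y.

In the variable y the factor sinh s of dw turns U_{a+1} into sinh((a+1)s), and folding y with -y
leaves i sin((a+1)jπ/r) times a Gaussian average of cosh(b arsinh x)/√(1+x²) at x = vy, where b =
2(a+1)/r (`thimble_integral_eq`). This function satisfies a second order linear equation, so its
even Taylor coefficients obey a two-term recurrence; multiplied by the Gaussian moments they become
the coefficients of `B` at 4v². The expansion follows as in Watson's lemma, from a Taylor remainder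
bound uniform in |Re x| ≥ δ|x|; compactness of the interval of arguments supplies δ. -/

namespace AiryLucas

/-! ### Change of time in a scalar separable equation -/

/-- `Ψ`, defined on `(-∞, T)`, is the inverse of the increasing function `Φ` with `Φ' = R`;
thus `Ψ` solves `Ψ' = 1 / R(Ψ)`. -/
structure IsTimeChange (R : ℝ → ℝ) (T : EReal) (Φ Ψ : ℝ → ℝ) : Prop where
  hasDerivAt : ∀ u, HasDerivAt Φ (R u) u
  strictMono : StrictMono Φ
  lt_iff : ∀ τ : ℝ, (τ : EReal) < T ↔ ∃ u, Φ u = τ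
  left_inv : ∀ u, Ψ (Φ u) = u
  hasDerivAt_inv : ∀ u, HasDerivAt Ψ (R u)⁻¹ (Φ u)
  tendsto_atBot : Tendsto Ψ atBot atBot
  bot_lt : ⊥ < T

/-- The lower bound near -∞ forces the primitive `Φ` of `R` to tend to -∞, so its range is a
half-line with end sup `Φ`. The supremum is taken in `EReal` because it is finite when the flow
blows up in finite time. -/
theorem exists_isTimeChange {R : ℝ → ℝ} (hR : Continuous R) (hpos : ∀ u, 0 < R u) {c : ℝ}
    (hc : 0 < c) (hlow : ∀ᶠ u in atBot, c ≤ R u) (τ₀ u₀ : ℝ) :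
    ∃ T Φ Ψ, IsTimeChange R T Φ Ψ ∧ Φ u₀ = τ₀ := by
  set Φ : ℝ → ℝ := fun u => τ₀ + ∫ s in u₀..u, R s with hΦ
  have hder : ∀ u, HasStrictDerivAt Φ (R u) u := fun u =>
    (hR.integral_hasStrictDerivAt u₀ u).const_add τ₀
  have hmono : StrictMono Φ := strictMono_of_hasDerivAt_pos (fun u => (hder u).hasDerivAt) hpos
  have hcont : Continuous Φ := continuous_iff_continuousAt.2 fun u => (hder u).hasDerivAt.continuousAt
  have hbot : Tendsto Φ atBot atBot := by
    obtain ⟨u₁, hu₁⟩ := eventually_atBot.1 hlow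
    have hm : MonotoneOn (fun u => Φ u - c * u) (Set.Iic u₁) := by
      have hd : ∀ u, HasDerivAt (fun u => Φ u - c * u) (R u - c) u := fun u => by
        simpa using (hder u).hasDerivAt.fun_sub ((hasDerivAt_id u).const_mul c)
      refine monotoneOn_of_deriv_nonneg (convex_Iic u₁)
        (fun u _ => (hd u).continuousAt.continuousWithinAt)
        (fun u _ => (hd u).differentiableAt.differentiableWithinAt) fun u hu => ?_
      rw [(hd u).deriv]
      have := hu₁ u (by simpa using (interior_subset hu))
      linarith
    have hlin : Tendsto (fun u => c * u + (Φ u₁ - c * u₁)) atBot atBot :=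
      tendsto_atBot_add_const_right _ _ (tendsto_id.const_mul_atBot hc)
    refine tendsto_atBot_mono' _ ?_ hlin
    filter_upwards [eventually_le_atBot u₁] with u hu
    have := hm (Set.mem_Iic.2 hu) (Set.mem_Iic.2 le_rfl) hu
    simp only at this
    linarith
  have hopen : IsOpenMap Φ := isOpenMap_of_hasStrictDerivAt hder fun u => (hpos u).ne'
  have hemb : IsOpenEmbedding Φ := .of_continuous_injective_isOpenMap hcont hmono.injective hopen
  set e := hemb.toOpenPartialHomeomorph with he
  have hleft : ∀ u, e.symm (Φ u) = u := fun u =>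
    e.left_inv (by simp [he])
  have hlt : ∀ τ : ℝ, (τ : EReal) < (⨆ u, (Φ u : EReal)) ↔ ∃ u, Φ u = τ := by
    intro τ
    constructor
    · intro h
      obtain ⟨u, hu⟩ := lt_iSup_iff.1 h
      obtain ⟨u', hu'⟩ := (hbot.eventually (eventually_le_atBot τ)).exists
      exact mem_range_of_exists_le_of_exists_ge hcont ⟨u', hu'⟩ ⟨u, (EReal.coe_lt_coe_iff.1 hu).le⟩
    · rintro ⟨u, rfl⟩
      exact lt_iSup_iff.2 ⟨u + 1, EReal.coe_lt_coe_iff.2 (hmono (lt_add_one u))⟩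
  refine ⟨⨆ u, (Φ u : EReal), Φ, e.symm, ⟨fun u => (hder u).hasDerivAt, hmono, hlt, hleft,
    fun u => ?_, ?_, ?_⟩, by simp [hΦ]⟩
  · refine e.hasDerivAt_symm (by simp [he]) (hpos u).ne' ?_
    rw [hleft]
    exact (hder u).hasDerivAt
  · refine tendsto_atBot.2 fun M => ?_
    filter_upwards [eventually_le_atBot (Φ M)] with τ hτ
    obtain ⟨u', hu'⟩ := (hbot.eventually (eventually_le_atBot τ)).exists
    obtain ⟨u, rfl⟩ := mem_range_of_exists_le_of_exists_ge hcont ⟨u', hu'⟩ ⟨M, hτ⟩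
    rw [hleft]
    exact hmono.le_iff_le.1 hτ
  · exact (EReal.bot_lt_coe (Φ 0)).trans ((hlt _).2 ⟨0, rfl⟩)

/-- If the density is bounded below, then the time change is defined for all times. -/
theorem IsTimeChange.eq_top_and_tendsto_atTop {R : ℝ → ℝ} {T : EReal} {Φ Ψ : ℝ → ℝ}
    (h : IsTimeChange R T Φ Ψ) {c : ℝ} (hc : 0 < c) (hlow : ∀ u, c ≤ R u) :
    T = ⊤ ∧ Tendsto Ψ atTop atTop := by
  have hm : Monotone (fun u => Φ u - c * u) := by
    have hd : ∀ u, HasDerivAt (fun u => Φ u - c * u) (R u - c) u := fun u => by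
      simpa using (h.hasDerivAt u).fun_sub ((hasDerivAt_id u).const_mul c)
    exact monotone_of_hasDerivAt_nonneg hd fun u => sub_nonneg.2 (hlow u)
  have htop : Tendsto Φ atTop atTop := by
    have hlin : Tendsto (fun u => c * u + Φ 0) atTop atTop :=
      tendsto_atTop_add_const_right _ _ (tendsto_id.const_mul_atTop hc)
    refine tendsto_atTop_mono' _ ?_ hlin
    filter_upwards [eventually_ge_atTop 0] with u hu
    have := hm hu
    simp only [mul_zero, sub_zero] at this
    linarith
  have hT : T = ⊤ := by
    refine EReal.eq_top_iff_forall_lt T |>.2 fun τ => ?_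
    obtain ⟨u, hu⟩ := (htop.eventually (eventually_gt_atTop τ)).exists
    exact (EReal.coe_lt_coe_iff.2 hu).trans ((h.lt_iff _).2 ⟨u, rfl⟩)
  refine ⟨hT, Filter.tendsto_atTop.2 fun M => ?_⟩
  filter_upwards [eventually_ge_atTop (Φ M)] with τ hτ
  obtain ⟨u, rfl⟩ := (h.lt_iff τ).1 (hT ▸ EReal.coe_lt_top τ)
  rw [h.left_inv]
  exact h.strictMono.le_iff_le.1 hτ

/-! ### Flow lines -/

theorem IsFlowLine.mono {f : ℂ → ℂ} {T T' : EReal} {z : ℝ → ℂ} (h : IsFlowLine f T z)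
    (hT : T' ≤ T) : IsFlowLine f T' z := fun τ hτ => h τ (hτ.trans_le hT)

theorem eventually_coe_lt_atBot {T : EReal} (hT : ⊥ < T) : ∀ᶠ τ : ℝ in atBot, (τ : EReal) < T := by
  obtain ⟨b, -, hb⟩ := EReal.lt_iff_exists_real_btwn.1 hT
  filter_upwards [eventually_le_atBot b] with τ hτ
  exact (EReal.coe_le_coe_iff.2 hτ).trans_lt hb

/-- Along a flow line `f` has real nonpositive derivative. -/
theorem IsFlowLine.hasDerivAt_comp {f : ℂ → ℂ} (hf : Differentiable ℂ f) {T : EReal} {z : ℝ → ℂ}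
    (h : IsFlowLine f T z) {τ : ℝ} (hτ : (τ : EReal) < T) :
    HasDerivAt (fun s => f (z s)) (-((‖deriv f (z τ)‖ ^ 2 : ℝ) : ℂ)) τ := by
  have := (hf (z τ)).hasDerivAt.comp_of_eq τ (h τ hτ) rfl
  refine this.congr_deriv ?_
  rw [mul_neg, Complex.mul_conj, Complex.normSq_eq_norm_sq]

/-- Along a flow line starting at `p` the values of `f` are `f p - D ^ 2` with `D` real. -/
theorem IsFlowLine.exists_comp_eq {f : ℂ → ℂ} (hf : Differentiable ℂ f) {T : EReal} {z : ℝ → ℂ}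
    (h : IsFlowLine f T z) {p : ℂ} (hz : Tendsto z atBot (𝓝 p)) {τ : ℝ} (hτ : (τ : EReal) < T) :
    ∃ D : ℝ, 0 ≤ D ∧ f (z τ) = f p - (D : ℂ) ^ 2 := by
  have hlt : ∀ s ∈ Set.Iic τ, (s : EReal) < T := fun s hs =>
    (EReal.coe_le_coe_iff.2 hs).trans_lt hτ
  have hd : ∀ s ∈ Set.Iic τ, HasDerivAt (fun s => f (z s)) (-((‖deriv f (z s)‖ ^ 2 : ℝ) : ℂ)) s :=
    fun s hs => h.hasDerivAt_comp hf (hlt s hs)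
  have hre : ∀ s ∈ Set.Iic τ, HasDerivAt (fun s => (f (z s)).re) (-(‖deriv f (z s)‖ ^ 2)) s :=
    fun s hs => by
      have := Complex.reCLM.hasFDerivAt.comp_hasDerivAt s (hd s hs)
      rw [Complex.reCLM_apply, Complex.neg_re, Complex.ofReal_re] at this
      exact this
  have him : ∀ s ∈ Set.Iic τ, HasDerivAt (fun s => (f (z s)).im) 0 s :=
    fun s hs => by
      have := Complex.imCLM.hasFDerivAt.comp_hasDerivAt s (hd s hs)
      rw [Complex.imCLM_apply, Complex.neg_im, Complex.ofReal_im, neg_zero] at this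
      exact this
  have hlim : Tendsto (fun s => f (z s)) atBot (𝓝 (f p)) := (hf.continuous.tendsto p).comp hz
  have hanti : AntitoneOn (fun s => (f (z s)).re) (Set.Iic τ) := by
    refine antitoneOn_of_deriv_nonpos (convex_Iic τ)
      (fun s hs => (hre s hs).continuousAt.continuousWithinAt)
      (fun s hs => (hre s (interior_subset hs)).differentiableAt.differentiableWithinAt)
      fun s hs => ?_
    rw [(hre s (interior_subset hs)).deriv]
    exact neg_nonpos.2 (sq_nonneg _)
  have hconst : ∀ s ∈ Set.Iic τ, (f (z s)).im = (f (z τ)).im := by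
    intro s hs
    refine (convex_Iic τ).is_const_of_fderivWithin_eq_zero (𝕜 := ℝ) (f := fun s => (f (z s)).im)
      (fun s hs => (him s hs).differentiableAt.differentiableWithinAt) (fun s hs => ?_) hs
      (Set.mem_Iic.2 le_rfl)
    have h0 := (him s hs).hasFDerivAt.hasFDerivWithinAt (s := Set.Iic τ)
    rw [h0.fderivWithin (uniqueDiffOn_Iic τ s hs)]
    ext; simp
  have h1 : (f (z τ)).re ≤ (f p).re := by
    refine ge_of_tendsto ((Complex.continuous_re.tendsto _).comp hlim) ?_
    filter_upwards [eventually_le_atBot τ] with s hs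
    exact hanti (Set.mem_Iic.2 hs) (Set.mem_Iic.2 le_rfl) hs
  have h2 : (f (z τ)).im = (f p).im := by
    refine tendsto_nhds_unique (f := fun s => (f (z s)).im) (l := atBot)
      (tendsto_const_nhds.congr' ?_)
      ((Complex.continuous_im.tendsto _).comp hlim)
    filter_upwards [eventually_le_atBot τ] with s hs
    exact (hconst s hs).symm
  refine ⟨√((f p).re - (f (z τ)).re), Real.sqrt_nonneg _, ?_⟩
  rw [← Complex.ofReal_pow, Real.sq_sqrt (sub_nonneg.2 h1)]
  apply Complex.ext <;> simp [h2]

/-- Two flow lines which meet at some time agree wherever both are defined. -/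
theorem IsFlowLine.eqOn {f : ℂ → ℂ} (hf : Differentiable ℂ f) {T : EReal} {z z' : ℝ → ℂ}
    (h : IsFlowLine f T z) (h' : IsFlowLine f T z') {τ₀ : ℝ} (hτ₀ : (τ₀ : EReal) < T)
    (heq : z τ₀ = z' τ₀) : Set.EqOn z z' {τ : ℝ | (τ : EReal) < T} := by
  intro τ hτ
  -- Uniqueness is applied on a compact interval with both times in its interior; there both curves
  -- stay in one ball, on which the C¹ field is Lipschitz.
  obtain ⟨b, hb, hbT⟩ := EReal.lt_iff_exists_real_btwn.1 (max_lt hτ hτ₀)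
  set a := min τ τ₀ - 1
  have hlt : ∀ s ∈ Set.Icc a b, (s : EReal) < T := fun s hs =>
    (EReal.coe_le_coe_iff.2 hs.2).trans_lt hbT
  have hτb : τ < b := EReal.coe_lt_coe_iff.1 ((le_max_left _ _).trans_lt hb)
  have hτ₀b : τ₀ < b := EReal.coe_lt_coe_iff.1 ((le_max_right _ _).trans_lt hb)
  have haτ : a < τ := (sub_one_lt _).trans_le (min_le_left _ _)
  have haτ₀ : a < τ₀ := (sub_one_lt _).trans_le (min_le_right _ _)
  have hcz : ContinuousOn z (Set.Icc a b) := fun s hs =>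
    (h s (hlt s hs)).continuousAt.continuousWithinAt
  have hcz' : ContinuousOn z' (Set.Icc a b) := fun s hs =>
    (h' s (hlt s hs)).continuousAt.continuousWithinAt
  obtain ⟨M, hM⟩ := (isCompact_Icc.image_of_continuousOn hcz).isBounded.union
    (isCompact_Icc.image_of_continuousOn hcz').isBounded |>.subset_closedBall 0
  have hsmooth : ContDiff ℝ 1 fun w => -conj (deriv f w) := by
    have h1 : ContDiff ℂ 1 (deriv f) := ((hf.contDiff (n := 1 + 1)).deriv' :)
    exact (Complex.conjCLE.contDiff.comp (h1.restrict_scalars ℝ)).neg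
  obtain ⟨K, hK⟩ := hsmooth.contDiffOn.exists_lipschitzOnWith one_ne_zero
    (convex_closedBall (0 : ℂ) M) (isCompact_closedBall 0 M)
  refine ODE_solution_unique_of_mem_Icc (v := fun _ w => -conj (deriv f w))
    (s := fun _ => Metric.closedBall 0 M) (fun _ _ => hK) ⟨haτ₀, hτ₀b⟩ hcz
    (fun s hs => h s (hlt s (Set.Ioo_subset_Icc_self hs)))
    (fun s hs => hM (Or.inl ⟨s, Set.Ioo_subset_Icc_self hs, rfl⟩)) hcz'
    (fun s hs => h' s (hlt s (Set.Ioo_subset_Icc_self hs)))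
    (fun s hs => hM (Or.inr ⟨s, Set.Ioo_subset_Icc_self hs, rfl⟩)) heq ⟨haτ.le, hτb.le⟩

/-- A curve along which `f` decreases along the reals becomes a flow line after a change of time. -/
theorem IsTimeChange.isFlowLine {f : ℂ → ℂ} (hf : Differentiable ℂ f) {c c' : ℝ → ℂ} {q R : ℝ → ℝ}
    {T : EReal} {Φ Ψ : ℝ → ℝ} (h : IsTimeChange R T Φ Ψ)
    (hc : ∀ u, HasDerivAt c (c' u) u) (hq : ∀ u, HasDerivAt (fun u => f (c u)) (-(q u : ℂ)) u)
    (hc' : ∀ u, c' u ≠ 0) (hR : ∀ u, R u * q u = ‖c' u‖ ^ 2) :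
    IsFlowLine f T fun τ => c (Ψ τ) := by
  intro τ hτ
  obtain ⟨u, rfl⟩ := (h.lt_iff τ).1 hτ
  have h1 := (hc u).scomp_of_eq (Φ u) (h.hasDerivAt_inv u) (h.left_inv u).symm
  refine h1.congr_deriv ?_
  simp only [h.left_inv]
  have h2 : deriv f (c u) * c' u = -(q u : ℂ) :=
    ((hf (c u)).hasDerivAt.comp_of_eq u (hc u) rfl).unique (hq u)
  have h3 : (R u : ℂ) * q u = c' u * conj (c' u) := by
    rw [Complex.mul_conj, Complex.normSq_eq_norm_sq, ← hR u]; push_cast; ring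
  have hcc : conj (c' u) ≠ 0 := (map_ne_zero _).2 (hc' u)
  have hR0 : (R u : ℂ) ≠ 0 := by
    intro h0
    rw [h0, zero_mul] at h3
    exact mul_ne_zero (hc' u) hcc h3.symm
  have h4 : conj (deriv f (c u)) * conj (c' u) = -(q u : ℂ) := by
    rw [← map_mul, h2]; simp
  rw [Complex.real_smul, Complex.ofReal_inv]
  -- As f'(c) c' = -q is real, conj f'(c) = -q / conj c' = -c' q / |c'|², and `R` q = |c'|².
  have h5 : conj (deriv f (c u)) = -(c' u / R u) := by
    field_simp
    apply mul_right_cancel₀ hcc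
    linear_combination (R u : ℂ) * h4 - h3
  rw [h5]
  field_simp

/-! ### Half thimbles parametrised by the square root of the descent of `f` -/

/-- An analytic curve `γ` through `p` such that `f (γ y) = f p - y ^ 2`. -/
structure IsDescentCurve (f : ℂ → ℂ) (p : ℂ) (γ : ℂ → ℂ) : Prop where
  differentiable : Differentiable ℂ f
  apply_zero : γ 0 = p
  comp_eq : ∀ y, f (γ y) = f p - y ^ 2
  analyticAt : ∀ y : ℝ, AnalyticAt ℂ γ y
  deriv_zero : deriv γ 0 ≠ 0

/-- The unit complex number with the argument of `x`. -/
noncomputable def unitVec (x : ℂ) : ℂ := x / (‖x‖ : ℂ)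

theorem continuousAt_unitVec {x : ℂ} (hx : x ≠ 0) : ContinuousAt unitVec x :=
  continuousAt_id.div (Complex.continuous_ofReal.comp continuous_norm).continuousAt
    (by simpa using hx)

theorem norm_unitVec {x : ℂ} (hx : x ≠ 0) : ‖unitVec x‖ = 1 := by
  simp [unitVec, hx]

theorem unitVec_pos_mul {y : ℝ} (hy : 0 < y) (x : ℂ) : unitVec (y * x) = unitVec x := by
  have : (y : ℂ) ≠ 0 := by exact_mod_cast hy.ne'
  simp only [unitVec, norm_mul, Complex.norm_real, Real.norm_of_nonneg hy.le, Complex.ofReal_mul]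
  exact mul_div_mul_left _ _ this

theorem unitVec_neg (x : ℂ) : unitVec (-x) = -unitVec x := by
  simp [unitVec, neg_div]

/-- The density of the flow time with respect to the logarithm of the curve parameter. -/
noncomputable def timeDensity (γ : ℂ → ℂ) (u : ℝ) : ℝ := ‖deriv γ (Real.exp u : ℝ)‖ ^ 2 / 2

namespace IsDescentCurve

variable {f : ℂ → ℂ} {p : ℂ} {γ : ℂ → ℂ}

theorem comp_neg (h : IsDescentCurve f p γ) : IsDescentCurve f p fun y => γ (-y) where
  differentiable := h.differentiable
  apply_zero := by simpa using h.apply_zero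
  comp_eq y := by rw [h.comp_eq, neg_sq]
  analyticAt y := by
    have := h.analyticAt (-y)
    rw [Complex.ofReal_neg] at this
    exact this.comp analyticAt_id.neg
  deriv_zero := by
    rw [deriv_comp_neg, neg_zero]
    exact neg_ne_zero.2 h.deriv_zero

theorem hasDerivAt (h : IsDescentCurve f p γ) (y : ℝ) : HasDerivAt γ (deriv γ y) y :=
  (h.analyticAt y).differentiableAt.hasDerivAt

/-- Differentiating f(γ y) = f p - y² gives f'(γ y) γ'(y) = -2y, which is nonzero away from y = 0.
-/
theorem deriv_ne_zero (h : IsDescentCurve f p γ) (y : ℝ) : deriv γ y ≠ 0 := by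
  rcases eq_or_ne y 0 with rfl | hy
  · simpa using h.deriv_zero
  intro h0
  have h1 : HasDerivAt (fun y => f (γ y)) (deriv f (γ y) * deriv γ y) (y : ℂ) :=
    (h.differentiable (γ y)).hasDerivAt.comp (y : ℂ) (h.hasDerivAt y)
  have h2 : HasDerivAt (fun y => f (γ y)) (-(2 * (y : ℂ))) (y : ℂ) := by
    have := ((hasDerivAt_id (y : ℂ)).fun_pow 2).const_sub (f p)
    simp only [id, ← h.comp_eq] at this
    simpa using this
  have := h1.unique h2
  rw [h0, mul_zero] at this
  apply hy
  have h3 : (y : ℂ) = 0 := by linear_combination this / 2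
  exact_mod_cast h3

theorem continuous_deriv (h : IsDescentCurve f p γ) : Continuous fun y : ℝ => deriv γ y :=
  continuous_iff_continuousAt.2 fun y =>
    ContinuousAt.comp (f := fun y : ℝ => (y : ℂ)) (h.analyticAt y).deriv.continuousAt
      Complex.continuous_ofReal.continuousAt

theorem tendsto_unitVec_slope (h : IsDescentCurve f p γ) :
    Tendsto (fun y => unitVec ((γ y - p) / y)) (𝓝[≠] 0) (𝓝 (unitVec (deriv γ 0))) := by
  have h1 : HasDerivAt γ (deriv γ 0) 0 := by simpa using h.hasDerivAt 0
  refine (continuousAt_unitVec h.deriv_zero).tendsto.comp ?_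
  refine (hasDerivAt_iff_tendsto_slope.1 h1).congr fun y => ?_
  rw [slope_def_field, h.apply_zero, sub_zero]

theorem continuous_timeDensity (h : IsDescentCurve f p γ) : Continuous (timeDensity γ) :=
  ((h.continuous_deriv.comp Real.continuous_exp).norm.pow 2).div_const 2

theorem timeDensity_pos (h : IsDescentCurve f p γ) (u : ℝ) : 0 < timeDensity γ u := by
  have := norm_pos_iff.2 (h.deriv_ne_zero (Real.exp u))
  unfold timeDensity
  positivity

/-- With y = e^u the time density tends to |γ'(0)|²/2 > 0 as u → -∞, so leaving p takes infinite
time. -/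
theorem exists_isTimeChange (h : IsDescentCurve f p γ) (τ₀ u₀ : ℝ) :
    ∃ T Φ Ψ, IsTimeChange (timeDensity γ) T Φ Ψ ∧ Φ u₀ = τ₀ := by
  have h0 : 0 < ‖deriv γ 0‖ ^ 2 / 2 := by
    have := norm_pos_iff.2 h.deriv_zero
    positivity
  refine AiryLucas.exists_isTimeChange h.continuous_timeDensity h.timeDensity_pos (half_pos h0) ?_
    τ₀ u₀
  have hlim : Tendsto (timeDensity γ) atBot (𝓝 (‖deriv γ 0‖ ^ 2 / 2)) := by
    have h1 : Tendsto (fun u => deriv γ (Real.exp u : ℝ)) atBot (𝓝 (deriv γ 0)) := by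
      have := (h.continuous_deriv.tendsto 0).comp Real.tendsto_exp_atBot
      rw [Complex.ofReal_zero] at this
      exact this
    exact (h1.norm.pow 2).div_const 2
  exact hlim.eventually_const_le (half_lt_self h0)

theorem hasDerivAt_comp_exp (h : IsDescentCurve f p γ) (u : ℝ) :
    HasDerivAt (fun u : ℝ => γ (Real.exp u : ℝ)) (Real.exp u * deriv γ (Real.exp u : ℝ)) u := by
  have := (h.hasDerivAt (Real.exp u)).comp_of_eq u (Real.hasDerivAt_exp u).ofReal_comp rfl
  rw [mul_comm] at this
  exact this

section timeChange

variable {T : EReal} {Φ Ψ : ℝ → ℝ}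

theorem isFlowLine (h : IsDescentCurve f p γ) (ht : IsTimeChange (timeDensity γ) T Φ Ψ) :
    IsFlowLine f T fun τ => γ (Real.exp (Ψ τ) : ℝ) := by
  refine ht.isFlowLine (c := fun u : ℝ => γ (Real.exp u : ℝ)) (q := fun u => 2 * Real.exp u ^ 2)
    h.differentiable h.hasDerivAt_comp_exp (fun u => ?_) (fun u => ?_) (fun u => ?_)
  · simp only [h.comp_eq]
    have := (((Real.hasDerivAt_exp u).ofReal_comp).fun_pow 2).const_sub (f p)
    refine this.congr_deriv ?_
    push_cast; ring
  · exact mul_ne_zero (by exact_mod_cast (Real.exp_pos u).ne') (h.deriv_ne_zero _)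
  · rw [norm_mul, Complex.norm_real, Real.norm_of_nonneg (Real.exp_pos u).le, timeDensity]
    ring

/-- Along the curve f equals f p - e^{2u}, which is unbounded. This excludes both a continuation
past a finite end time and convergence to a critical point. -/
theorem not_tendsto (h : IsDescentCurve f p γ) (w : ℂ) {z : ℝ → ℂ} {l : Filter ℝ}
    (hz : ∀ u, z (Φ u) = γ (Real.exp u : ℝ))
    (hl : Tendsto Φ atTop l) : ¬ Tendsto z l (𝓝 w) := by
  intro hlim
  have h1 : Tendsto (fun u => f (z (Φ u))) atTop (𝓝 (f w)) :=
    (h.differentiable.continuous.tendsto w).comp (hlim.comp hl)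
  simp only [hz, h.comp_eq] at h1
  have h2 := ((h1.const_sub (f p)).norm)
  simp only [sub_sub_cancel, norm_pow, Complex.norm_real, Real.norm_eq_abs, Real.abs_exp] at h2
  exact not_tendsto_nhds_of_tendsto_atTop
    ((tendsto_pow_atTop two_ne_zero).comp Real.tendsto_exp_atTop) _ h2

theorem isHalfThimble (h : IsDescentCurve f p γ) (ht : IsTimeChange (timeDensity γ) T Φ Ψ) :
    IsHalfThimble f p (unitVec (deriv γ 0)) T fun τ => γ (Real.exp (Ψ τ) : ℝ) where
  bot_lt := ht.bot_lt
  flow := h.isFlowLine ht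
  maximal := by
    intro T' z' hT hz' heq
    -- A proper extension requires a finite end time `b`; being continuous there, it would make
    -- γ(e^u) converge as u → ∞.
    obtain ⟨b, rfl⟩ : ∃ b : ℝ, T = b := by
      induction T with
      | bot => exact absurd ht.bot_lt (lt_irrefl _)
      | top => exact absurd hT not_top_lt
      | coe b => exact ⟨b, rfl⟩
    have hlt : ∀ u, Φ u < b := fun u => EReal.coe_lt_coe_iff.1 ((ht.lt_iff _).2 ⟨u, rfl⟩)
    have hl : Tendsto Φ atTop (𝓝 b) := by
      refine tendsto_order.2 ⟨fun a ha => ?_, fun a ha => Eventually.of_forall fun u =>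
        (hlt u).trans ha⟩
      obtain ⟨u, rfl⟩ := (ht.lt_iff a).1 (EReal.coe_lt_coe_iff.2 ha)
      filter_upwards [eventually_gt_atTop u] with u' hu' using ht.strictMono hu'
    refine h.not_tendsto (z' b) (fun u => ?_) hl (hz' b hT).continuousAt.tendsto
    rw [heq ((ht.lt_iff _).2 ⟨u, rfl⟩)]
    simp only [ht.left_inv]
  tendsto_start := by
    have h1 : Tendsto (fun y : ℝ => γ y) (𝓝 0) (𝓝 (γ 0)) := by
      have := (h.hasDerivAt 0).continuousAt.tendsto.comp (Complex.continuous_ofReal.tendsto 0)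
      rw [Complex.ofReal_zero] at this
      exact this
    rw [h.apply_zero] at h1
    exact h1.comp (Real.tendsto_exp_atBot.comp ht.tendsto_atBot)
  direction := by
    have h1 : Tendsto (fun τ => ((Real.exp (Ψ τ) : ℝ) : ℂ)) atBot (𝓝[≠] 0) := by
      refine tendsto_nhdsWithin_iff.2 ⟨?_, Eventually.of_forall fun τ => ?_⟩
      · have := (Complex.continuous_ofReal.tendsto 0).comp
          (Real.tendsto_exp_atBot.comp ht.tendsto_atBot)
        rw [Complex.ofReal_zero] at this
        exact this
      · exact Complex.ofReal_ne_zero.2 (Real.exp_pos _).ne'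
    refine (h.tendsto_unitVec_slope.comp h1).congr fun τ => ?_
    have h2 : ((Real.exp (Ψ τ) : ℝ) : ℂ) ≠ 0 := Complex.ofReal_ne_zero.2 (Real.exp_pos _).ne'
    rw [Function.comp_apply, ← unitVec_pos_mul (Real.exp_pos (Ψ τ)), mul_div_cancel₀ _ h2, unitVec]
  not_stokes := by
    rintro ⟨rfl, q, -, -, hq⟩
    refine h.not_tendsto q (Φ := Φ) (fun u => by simp only [ht.left_inv]) ?_ hq
    refine Filter.tendsto_atTop.2 fun M => ?_
    obtain ⟨u, rfl⟩ := (ht.lt_iff M).1 (EReal.coe_lt_top M)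
    filter_upwards [eventually_ge_atTop u] with u' hu' using ht.strictMono.monotone hu'

/-- Contour integrals in the flow time and in the curve parameter. -/
theorem integral_timeChange (h : IsDescentCurve f p γ) (ht : IsTimeChange (timeDensity γ) T Φ Ψ)
    {z : ℝ → ℂ} (hz : Set.EqOn z (fun τ => γ (Real.exp (Ψ τ) : ℝ)) {τ : ℝ | (τ : EReal) < T})
    (F : ℂ → ℂ) :
    (IntegrableOn (fun τ => F (z τ) * deriv z τ) {τ : ℝ | (τ : EReal) < T} ↔
      IntegrableOn (fun y : ℝ => F (γ y) * deriv γ y) (Set.Ioi 0)) ∧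
    ∫ τ in {τ : ℝ | (τ : EReal) < T}, F (z τ) * deriv z τ =
      ∫ y : ℝ in Set.Ioi 0, F (γ y) * deriv γ y := by
  have hrange : Φ '' Set.univ = {τ : ℝ | (τ : EReal) < T} := by
    ext τ; simp [ht.lt_iff]
  have hexp : Real.exp '' Set.univ = Set.Ioi 0 := by
    rw [Set.image_univ, Real.range_exp]
  have hopen : IsOpen {τ : ℝ | (τ : EReal) < T} :=
    isOpen_lt continuous_coe_real_ereal continuous_const
  -- Both integrals are pulled back to the line of u = log y, through `Φ` and through `exp`; the two
  -- integrands then coincide.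
  have key : ∀ u, |timeDensity γ u| • (F (z (Φ u)) * deriv z (Φ u)) =
      |Real.exp u| • (F (γ (Real.exp u : ℝ)) * deriv γ (Real.exp u : ℝ)) := by
    intro u
    have hmem : Φ u ∈ {τ : ℝ | (τ : EReal) < T} := (ht.lt_iff _).2 ⟨u, rfl⟩
    have h1 : z =ᶠ[𝓝 (Φ u)] fun τ => γ (Real.exp (Ψ τ) : ℝ) :=
      hz.eventuallyEq_of_mem (hopen.mem_nhds hmem)
    have h2 : deriv z (Φ u) = (timeDensity γ u)⁻¹ •
        (Real.exp u * deriv γ (Real.exp u : ℝ)) := by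
      rw [h1.deriv_eq]
      exact ((h.hasDerivAt_comp_exp u).scomp_of_eq (Φ u) (ht.hasDerivAt_inv u)
        (ht.left_inv u).symm).deriv
    have h3 : (timeDensity γ u : ℂ) ≠ 0 := Complex.ofReal_ne_zero.2 (h.timeDensity_pos u).ne'
    rw [h2, h1.eq_of_nhds, ht.left_inv, abs_of_pos (h.timeDensity_pos u), Real.abs_exp]
    simp only [Complex.real_smul, Complex.ofReal_inv]
    field_simp
  have hΦ : ∀ u ∈ Set.univ, HasDerivWithinAt Φ (timeDensity γ u) Set.univ u := fun u _ =>
    (ht.hasDerivAt u).hasDerivWithinAt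
  have hE : ∀ u ∈ Set.univ, HasDerivWithinAt Real.exp (Real.exp u) Set.univ u := fun u _ =>
    (Real.hasDerivAt_exp u).hasDerivWithinAt
  constructor
  · rw [← hrange, ← hexp, integrableOn_image_iff_integrableOn_abs_deriv_smul MeasurableSet.univ hΦ
      ht.strictMono.injective.injOn, integrableOn_image_iff_integrableOn_abs_deriv_smul
      MeasurableSet.univ hE Real.exp_injective.injOn]
    simp only [key]
  · rw [← hrange, ← hexp, integral_image_eq_integral_abs_deriv_smul MeasurableSet.univ hΦ
      ht.strictMono.injective.injOn, integral_image_eq_integral_abs_deriv_smul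
      MeasurableSet.univ hE Real.exp_injective.injOn]
    simp only [key]

end timeChange

/-- A half thimble leaving `p` in the direction of `γ` meets `γ`. -/
theorem exists_apply_eq (h : IsDescentCurve f p γ) {T : EReal} {z : ℝ → ℂ}
    (hz : IsHalfThimble f p (unitVec (deriv γ 0)) T z) :
    ∃ τ₀ : ℝ, (τ₀ : EReal) < T ∧ ∃ y : ℝ, 0 < y ∧ z τ₀ = γ y := by
  set e := unitVec (deriv γ 0) with he
  -- The parameter is still complex here, hence the slope (γ y - p)/y instead of γ y - p.
  have hnear : ∀ᶠ y in 𝓝 (0 : ℂ), y ≠ 0 → ‖unitVec ((γ y - p) / y) - e‖ < 1 := by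
    have := Metric.tendsto_nhds.1 h.tendsto_unitVec_slope 1 one_pos
    simp only [dist_eq_norm] at this
    exact eventually_nhdsWithin_iff.1 this
  have hmap : map γ (𝓝 0) = 𝓝 p := by
    have h1 : HasStrictDerivAt γ (deriv γ 0) 0 := by
      simpa using (h.analyticAt 0).hasStrictDerivAt
    rw [h1.map_nhds_eq h.deriv_zero, h.apply_zero]
  have himg : γ '' {y | y ≠ 0 → ‖unitVec ((γ y - p) / y) - e‖ < 1} ∈ 𝓝 p := by
    rw [← hmap]
    exact image_mem_map hnear
  have hdir : ∀ᶠ τ in atBot, ‖unitVec (z τ - p) - e‖ < 1 := by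
    have := Metric.tendsto_nhds.1 hz.direction 1 one_pos
    simp only [dist_eq_norm] at this
    exact this
  obtain ⟨τ, ⟨hτT, hd⟩, y, hy, hyz⟩ := ((eventually_coe_lt_atBot hz.bot_lt).and hdir).and
    (hz.tendsto_start.eventually himg) |>.exists
  -- The vector `unitVec 0` is 0 by convention, at distance exactly 1 from e.
  have hne : y ≠ 0 := by
    rintro rfl
    rw [← hyz, h.apply_zero, sub_self] at hd
    have h1 : ‖unitVec 0 - e‖ = 1 := by
      rw [he, ← norm_unitVec h.deriv_zero]; simp [unitVec]
    linarith
  obtain ⟨D, hD0, hD⟩ := hz.flow.exists_comp_eq h.differentiable hz.tendsto_start hτT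
  -- Comparing f p - y² with f p - D² leaves only y = ±D, so the parameter is real.
  rw [← hyz, h.comp_eq, sub_right_inj, sq_eq_sq_iff_eq_or_eq_neg] at hD
  refine ⟨τ, hτT, D, hD0.lt_of_ne ?_, ?_⟩
  · rintro rfl
    exact hne (by simpa using hD)
  rcases hD with rfl | rfl
  · exact hyz.symm
  -- If y = -D, a vector and its negative would both be at distance less than 1 from the unit vector
  -- e, contradicting |2e| = 2.
  · exfalso
    have hDpos : 0 < D := hD0.lt_of_ne (by rintro rfl; simp at hne)
    have h1 := hy hne
    have h2 : unitVec (z τ - p) = -unitVec ((γ (-(D : ℂ)) - p) / -(D : ℂ)) := by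
      rw [← hyz, ← unitVec_neg, ← unitVec_pos_mul hDpos (-_)]
      congr 1
      have : (D : ℂ) ≠ 0 := Complex.ofReal_ne_zero.2 hDpos.ne'
      field_simp
    rw [h2] at hd
    have h3 : ‖(2 : ℂ) * e‖ = 2 := by rw [norm_mul, norm_unitVec h.deriv_zero]; simp
    set v := unitVec ((γ (-(D : ℂ)) - p) / -(D : ℂ))
    have h4 : ‖(2 : ℂ) * e‖ ≤ ‖v - e‖ + ‖-v - e‖ := by
      rw [← norm_neg]
      refine le_trans (le_of_eq ?_) (norm_add_le _ _)
      congr 1; ring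
    linarith

/-- A half thimble leaving `p` in the direction of `γ` is `γ` up to a change of time. -/
theorem exists_timeChange_of_isHalfThimble (h : IsDescentCurve f p γ) {T : EReal} {z : ℝ → ℂ}
    (hz : IsHalfThimble f p (unitVec (deriv γ 0)) T z) :
    ∃ Φ Ψ, IsTimeChange (timeDensity γ) T Φ Ψ ∧
      Set.EqOn z (fun τ => γ (Real.exp (Ψ τ) : ℝ)) {τ : ℝ | (τ : EReal) < T} := by
  obtain ⟨τ₀, hτ₀, y, hy, hzy⟩ := h.exists_apply_eq hz
  obtain ⟨T₁, Φ, Ψ, ht, hΦ⟩ := h.exists_isTimeChange τ₀ (Real.log y)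
  have hz₁ := h.isHalfThimble ht
  have hτ₁ : (τ₀ : EReal) < T₁ := (ht.lt_iff _).2 ⟨_, hΦ⟩
  have h0 : z τ₀ = γ (Real.exp (Ψ τ₀) : ℝ) := by
    rw [← hΦ, ht.left_inv, Real.exp_log hy, hΦ, hzy]
  -- The two lines agree up to the smaller end time, so unequal end times contradict the maximality
  -- of the shorter line.
  rcases lt_trichotomy T T₁ with hlt | rfl | hlt
  · exact absurd ((hz.flow.eqOn h.differentiable (hz₁.flow.mono hlt.le) hτ₀ h0).symm)
      (hz.maximal T₁ _ hlt hz₁.flow)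
  · exact ⟨Φ, Ψ, ht, hz.flow.eqOn h.differentiable hz₁.flow hτ₀ h0⟩
  · exact absurd ((hz.flow.mono hlt.le).eqOn h.differentiable hz₁.flow hτ₁ h0)
      (hz₁.maximal T z hlt hz.flow)

/-- The reversed curve y ↦ γ(-y) is again a descent curve and supplies the incoming half. -/
theorem nonempty_lefschetzThimble (h : IsDescentCurve f p γ) :
    Nonempty (LefschetzThimble f p (unitVec (deriv γ 0))) := by
  obtain ⟨T, Φ, Ψ, ht, -⟩ := h.exists_isTimeChange 0 0
  obtain ⟨T', Φ', Ψ', ht', -⟩ := h.comp_neg.exists_isTimeChange 0 0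
  have h' := h.comp_neg.isHalfThimble ht'
  rw [deriv_comp_neg, neg_zero, unitVec_neg] at h'
  exact ⟨⟨T', T, _, _, h', h.isHalfThimble ht⟩⟩

/-- Contour integrals over a Lefschetz thimble, computed along the descent curve. -/
theorem integral_lefschetzThimble (h : IsDescentCurve f p γ)
    {e : ℂ} (he : unitVec (deriv γ 0) = e) (Γ : LefschetzThimble f p e) (F : ℂ → ℂ)
    (hF : Integrable fun y : ℝ => F (γ y) * deriv γ y) :
    Γ.Converges F ∧
      Γ.integral F = ∫ y : ℝ in Set.Ioi 0,
        (F (γ y) * deriv γ y + F (γ (-y)) * deriv γ (-y)) := by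
  subst he
  have hin := Γ.isHalf_in
  have hneg : -unitVec (deriv γ 0) = unitVec (deriv (fun y => γ (-y)) 0) := by
    rw [deriv_comp_neg, neg_zero, unitVec_neg]
  rw [hneg] at hin
  obtain ⟨Φ, Ψ, ht, heq⟩ := h.exists_timeChange_of_isHalfThimble Γ.isHalf_out
  obtain ⟨Φ', Ψ', ht', heq'⟩ := h.comp_neg.exists_timeChange_of_isHalfThimble hin
  have hout := h.integral_timeChange ht heq F
  have hin := h.comp_neg.integral_timeChange ht' heq' F
  have hF' : Integrable fun y : ℝ => F (γ (-y)) * deriv γ (-y) := by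
    simpa using hF.comp_neg
  simp only [deriv_comp_neg, mul_neg] at hin
  refine ⟨⟨hin.1.2 hF'.neg.integrableOn, hout.1.2 hF.integrableOn⟩, ?_⟩
  -- The sign from differentiating γ(-y) cancels the minus sign of the incoming half.
  rw [LefschetzThimble.integral, hout.2, hin.2, integral_neg, sub_neg_eq_add,
    integral_add hF.integrableOn hF'.integrableOn]

end IsDescentCurve

/-! ### The complex inverse hyperbolic sine -/

/-- The principal branch of `√(1 + x ^ 2)`. -/
noncomputable def sqrtOneAddSq (x : ℂ) : ℂ := Complex.sqrt (1 + x ^ 2)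

/-- The principal branch of the inverse hyperbolic sine. -/
noncomputable def arsinh (x : ℂ) : ℂ := Complex.log (x + sqrtOneAddSq x)

theorem sqrtOneAddSq_sq (x : ℂ) : sqrtOneAddSq x ^ 2 = 1 + x ^ 2 := by
  simp [sqrtOneAddSq, Complex.sqrt]

theorem sqrtOneAddSq_zero : sqrtOneAddSq 0 = 1 := by simp [sqrtOneAddSq]

theorem sqrtOneAddSq_neg (x : ℂ) : sqrtOneAddSq (-x) = sqrtOneAddSq x := by simp [sqrtOneAddSq]

theorem add_mul_sqrtOneAddSq_sub (x : ℂ) : (x + sqrtOneAddSq x) * (sqrtOneAddSq x - x) = 1 := by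
  linear_combination sqrtOneAddSq_sq x

theorem add_sqrtOneAddSq_ne_zero (x : ℂ) : x + sqrtOneAddSq x ≠ 0 :=
  left_ne_zero_of_mul_eq_one (add_mul_sqrtOneAddSq_sub x)

theorem exp_arsinh (x : ℂ) : Complex.exp (arsinh x) = x + sqrtOneAddSq x :=
  Complex.exp_log (add_sqrtOneAddSq_ne_zero x)

theorem exp_neg_arsinh (x : ℂ) : Complex.exp (-arsinh x) = sqrtOneAddSq x - x := by
  rw [Complex.exp_neg, exp_arsinh]
  exact inv_eq_of_mul_eq_one_right (add_mul_sqrtOneAddSq_sub x)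

theorem sinh_arsinh (x : ℂ) : Complex.sinh (arsinh x) = x := by
  rw [Complex.sinh, exp_arsinh, exp_neg_arsinh]; ring

theorem arsinh_zero : arsinh 0 = 0 := by simp [arsinh, sqrtOneAddSq_zero]

theorem re_sqrtOneAddSq_pos {x : ℂ} (hx : 1 + x ^ 2 ∈ Complex.slitPlane) :
    0 < (sqrtOneAddSq x).re := by
  rw [sqrtOneAddSq, sqrt_eq_exp (Complex.slitPlane_ne_zero hx), Complex.exp_re]
  refine mul_pos (Real.exp_pos _) (Real.cos_pos_of_mem_Ioo ?_)
  have h1 := (Complex.log_im (1 + x ^ 2)) ▸ Complex.neg_pi_lt_arg (1 + x ^ 2)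
  have h2 := (Complex.log_im (1 + x ^ 2)) ▸ (Complex.arg_le_pi (1 + x ^ 2)).lt_of_ne
    (Complex.slitPlane_arg_ne_pi hx)
  have h3 : (Complex.log (1 + x ^ 2) / 2).im = (Complex.log (1 + x ^ 2)).im / 2 := by simp
  rw [h3]
  constructor <;> linarith

theorem sqrtOneAddSq_ne_zero {x : ℂ} (hx : 1 + x ^ 2 ∈ Complex.slitPlane) :
    sqrtOneAddSq x ≠ 0 := fun h => by
  have := re_sqrtOneAddSq_pos hx
  simp [h] at this

/-- If x + √(1+x²) were a real k ≤ 0, then k ≠ 0 and √(1+x²) = (k + 1/k)/2 ≤ 0, against the positive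
real part of the principal root. -/
theorem add_sqrtOneAddSq_mem_slitPlane {x : ℂ} (hx : 1 + x ^ 2 ∈ Complex.slitPlane) :
    x + sqrtOneAddSq x ∈ Complex.slitPlane := by
  rw [Complex.mem_slitPlane_iff]
  by_contra! h
  set k := (x + sqrtOneAddSq x).re with hk
  have h1 : x + sqrtOneAddSq x = (k : ℂ) := Complex.ext (by simp [hk]) (by simpa using h.2)
  have h2 := add_mul_sqrtOneAddSq_sub x
  rw [h1] at h2
  have hk0 : k ≠ 0 := by rintro h0; rw [h0] at h2; simp at h2
  have h3 : sqrtOneAddSq x = ((k + k⁻¹) / 2 : ℝ) := by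
    have h4 : (k : ℂ) ≠ 0 := by exact_mod_cast hk0
    have h5 : sqrtOneAddSq x - x = (k : ℂ)⁻¹ := (eq_inv_of_mul_eq_one_right h2)
    push_cast
    linear_combination (h1 + h5) / 2
  have h4 := re_sqrtOneAddSq_pos hx
  rw [h3, Complex.ofReal_re] at h4
  have : k⁻¹ ≤ 0 := inv_nonpos.2 h.1
  linarith [h.1]

theorem arsinh_neg {x : ℂ} (hx : 1 + x ^ 2 ∈ Complex.slitPlane) : arsinh (-x) = -arsinh x := by
  rw [arsinh, arsinh, sqrtOneAddSq_neg, ← Complex.log_inv _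
    (Complex.slitPlane_arg_ne_pi (add_sqrtOneAddSq_mem_slitPlane hx))]
  congr 1
  rw [neg_add_eq_sub]
  exact eq_inv_of_mul_eq_one_right (add_mul_sqrtOneAddSq_sub x)

theorem hasDerivAt_sqrtOneAddSq {x : ℂ} (hx : 1 + x ^ 2 ∈ Complex.slitPlane) :
    HasDerivAt sqrtOneAddSq (x / sqrtOneAddSq x) x := by
  have h1 : HasDerivAt (fun x : ℂ => 1 + x ^ 2) (2 * x) x := by
    simpa using (hasDerivAt_pow 2 x).const_add (1 : ℂ)
  have h2 : DifferentiableAt ℂ sqrtOneAddSq x :=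
    (Complex.hasDerivAt_sqrt hx).differentiableAt.comp x h1.differentiableAt
  have h3 := h2.hasDerivAt.fun_pow 2
  simp only [sqrtOneAddSq_sq] at h3
  have h4 := h3.unique h1
  have h5 := sqrtOneAddSq_ne_zero hx
  refine h2.hasDerivAt.congr_deriv ?_
  rw [eq_div_iff h5]
  simp only [Nat.cast_ofNat, Nat.add_one_sub_one, pow_one] at h4
  linear_combination h4 / 2

theorem hasDerivAt_arsinh {x : ℂ} (hx : 1 + x ^ 2 ∈ Complex.slitPlane) :
    HasDerivAt arsinh (1 / sqrtOneAddSq x) x := by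
  have h1 := ((hasDerivAt_id x).fun_add (hasDerivAt_sqrtOneAddSq hx)).clog
    (add_sqrtOneAddSq_mem_slitPlane hx)
  refine h1.congr_deriv ?_
  have h5 := sqrtOneAddSq_ne_zero hx
  have h6 := add_sqrtOneAddSq_ne_zero x
  simp only [id]
  field_simp
  ring

theorem isOpen_arsinh_domain : IsOpen {x : ℂ | 1 + x ^ 2 ∈ Complex.slitPlane} :=
  Complex.isOpen_slitPlane.preimage (by fun_prop)

theorem zero_mem_arsinh_domain : (0 : ℂ) ∈ {x : ℂ | 1 + x ^ 2 ∈ Complex.slitPlane} := by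
  simp [Complex.one_mem_slitPlane]

/-- The branch cuts of the inverse hyperbolic sine lie on the imaginary axis. -/
theorem mem_arsinh_domain_of_re_ne_zero {v : ℂ} (hv : v.re ≠ 0) (y : ℝ) :
    1 + (v * y) ^ 2 ∈ Complex.slitPlane := by
  rw [Complex.mem_slitPlane_iff]
  by_contra! h
  have hre : (1 + (v * y) ^ 2).re = 1 + y ^ 2 * (v.re ^ 2 - v.im ^ 2) := by
    simp [pow_two]; ring
  have him : (1 + (v * y) ^ 2).im = 2 * y ^ 2 * v.re * v.im := by
    simp [pow_two]; ring
  rw [hre, him] at h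
  rcases mul_eq_zero.1 h.2 with h0 | h0
  · have : y = 0 := by simpa [hv] using h0
    rw [this] at h
    norm_num at h
  · rw [h0] at h
    nlinarith [h.1, mul_nonneg (sq_nonneg y) (sq_nonneg v.re)]

/-! #### Growth -/

theorem norm_sqrtOneAddSq_le (x : ℂ) : ‖sqrtOneAddSq x‖ ≤ 1 + ‖x‖ := by
  refine (pow_le_pow_iff_left₀ (by positivity) (by positivity) two_ne_zero).1 ?_
  rw [← norm_pow, sqrtOneAddSq_sq]
  have := norm_add_le 1 (x ^ 2)
  rw [norm_one, norm_pow] at this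
  nlinarith [norm_nonneg x]

/-- Both e^{arsinh x} and e^{-arsinh x} are √(1+x²) ± x. The resulting polynomial growth is harmless
against the Gaussian. -/
theorem exp_abs_re_arsinh_le (x : ℂ) : Real.exp |(arsinh x).re| ≤ 2 * ‖x‖ + 1 := by
  have h1 := norm_sqrtOneAddSq_le x
  rcases abs_choice (arsinh x).re with h | h <;> rw [h]
  · rw [← Complex.norm_exp, exp_arsinh]
    linarith [norm_add_le x (sqrtOneAddSq x)]
  · rw [← Complex.neg_re, ← Complex.norm_exp, exp_neg_arsinh]
    linarith [norm_sub_le (sqrtOneAddSq x) x]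

theorem norm_exp_mul_arsinh_le {b : ℝ} (hb : |b| ≤ 2) (x : ℂ) :
    ‖Complex.exp (b * arsinh x)‖ ≤ (2 * ‖x‖ + 1) ^ 2 := by
  rw [Complex.norm_exp, Complex.re_ofReal_mul]
  calc Real.exp (b * (arsinh x).re) ≤ Real.exp (2 * |(arsinh x).re|) :=
        Real.exp_le_exp.2 ((le_abs_self _).trans (by rw [abs_mul]; gcongr))
    _ = Real.exp |(arsinh x).re| ^ 2 := by rw [← Real.exp_nat_mul]; simp
    _ ≤ _ := by gcongr; exact exp_abs_re_arsinh_le x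

theorem norm_cosh_mul_arsinh_le {b : ℝ} (hb : |b| ≤ 2) (x : ℂ) :
    ‖Complex.cosh (b * arsinh x)‖ ≤ (2 * ‖x‖ + 1) ^ 2 := by
  have h1 := norm_exp_mul_arsinh_le hb x
  have h2 := norm_exp_mul_arsinh_le (b := -b) (by rwa [abs_neg]) x
  rw [Complex.ofReal_neg, neg_mul] at h2
  rw [Complex.cosh, norm_div, Complex.norm_ofNat, div_le_iff₀ two_pos]
  linarith [norm_add_le (Complex.exp (b * arsinh x)) (Complex.exp (-(b * arsinh x)))]

theorem norm_sinh_mul_arsinh_le {b : ℝ} (hb : |b| ≤ 2) (x : ℂ) :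
    ‖Complex.sinh (b * arsinh x)‖ ≤ (2 * ‖x‖ + 1) ^ 2 := by
  have h1 := norm_exp_mul_arsinh_le hb x
  have h2 := norm_exp_mul_arsinh_le (b := -b) (by rwa [abs_neg]) x
  rw [Complex.ofReal_neg, neg_mul] at h2
  rw [Complex.sinh, norm_div, Complex.norm_ofNat, div_le_iff₀ two_pos]
  linarith [norm_sub_le (Complex.exp (b * arsinh x)) (Complex.exp (-(b * arsinh x)))]

/-- Factor 1 + x² = (x+i)(x-i). Each factor has modulus at least δ/2: by the triangle inequality if
|x| ≤ 1/2, and through its real part otherwise. -/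
theorem le_norm_sqrtOneAddSq {δ : ℝ} (hδ0 : 0 ≤ δ) (hδ1 : δ ≤ 1) {x : ℂ}
    (hx : δ * ‖x‖ ≤ |x.re|) : δ / 2 ≤ ‖sqrtOneAddSq x‖ := by
  have key : ∀ w : ℂ, w.re = 0 → ‖w‖ = 1 → δ / 2 ≤ ‖x + w‖ := by
    intro w hw hw1
    have h1 : |x.re| ≤ ‖x + w‖ := by
      have := Complex.abs_re_le_norm (x + w)
      rwa [Complex.add_re, hw, add_zero] at this
    have h2 : 1 - ‖x‖ ≤ ‖x + w‖ := by
      have := norm_sub_norm_le w (-x)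
      rw [norm_neg, sub_neg_eq_add, hw1, add_comm w x] at this
      exact this
    rcases le_total ‖x‖ (1 / 2) with h | h
    · linarith
    · nlinarith
  refine (pow_le_pow_iff_left₀ (by positivity) (by positivity) two_ne_zero).1 ?_
  rw [← norm_pow, sqrtOneAddSq_sq, show 1 + x ^ 2 = (x + Complex.I) * (x + -Complex.I) by
    linear_combination Complex.I_sq, norm_mul, sq]
  exact mul_le_mul (key _ Complex.I_re Complex.norm_I) (key _ (by simp) (by simp)) (by linarith)
    (norm_nonneg _)

/-! ### Gaussian averages of `cosh (b arsinh x) / √(1 + x ^ 2)` -/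

/-- The function `cosh (b arsinh x) / √(1 + x ^ 2)`. -/
noncomputable def coshQuot (b : ℝ) (x : ℂ) : ℂ := Complex.cosh (b * arsinh x) / sqrtOneAddSq x

theorem hasDerivAt_cosh_mul_arsinh (b : ℝ) {x : ℂ} (hx : 1 + x ^ 2 ∈ Complex.slitPlane) :
    HasDerivAt (fun x => Complex.cosh (b * arsinh x))
      (b * Complex.sinh (b * arsinh x) / sqrtOneAddSq x) x := by
  refine ((hasDerivAt_arsinh hx).const_mul (b : ℂ)).ccosh.congr_deriv ?_
  ring

theorem hasDerivAt_sinh_mul_arsinh (b : ℝ) {x : ℂ} (hx : 1 + x ^ 2 ∈ Complex.slitPlane) :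
    HasDerivAt (fun x => Complex.sinh (b * arsinh x))
      (b * Complex.cosh (b * arsinh x) / sqrtOneAddSq x) x := by
  refine ((hasDerivAt_arsinh hx).const_mul (b : ℂ)).csinh.congr_deriv ?_
  ring

theorem hasDerivAt_coshQuot (b : ℝ) {x : ℂ} (hx : 1 + x ^ 2 ∈ Complex.slitPlane) :
    HasDerivAt (coshQuot b) (b * Complex.sinh (b * arsinh x) / sqrtOneAddSq x ^ 2 -
      x * Complex.cosh (b * arsinh x) / sqrtOneAddSq x ^ 3) x := by
  have h0 := sqrtOneAddSq_ne_zero hx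
  refine ((hasDerivAt_cosh_mul_arsinh b hx).fun_div (hasDerivAt_sqrtOneAddSq hx) h0).congr_deriv ?_
  field_simp

theorem analyticAt_coshQuot (b : ℝ) {x : ℂ} (hx : 1 + x ^ 2 ∈ Complex.slitPlane) :
    AnalyticAt ℂ (coshQuot b) x :=
  DifferentiableOn.analyticAt (fun _ hy =>
    (hasDerivAt_coshQuot b hy).differentiableAt.differentiableWithinAt)
    (isOpen_arsinh_domain.mem_nhds hx)

theorem iteratedDeriv_one_coshQuot (b : ℝ) {x : ℂ} (hx : 1 + x ^ 2 ∈ Complex.slitPlane) :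
    iteratedDeriv 1 (coshQuot b) x = b * Complex.sinh (b * arsinh x) / sqrtOneAddSq x ^ 2 -
      x * Complex.cosh (b * arsinh x) / sqrtOneAddSq x ^ 3 := by
  rw [iteratedDeriv_one, (hasDerivAt_coshQuot b hx).deriv]

theorem hasDerivAt_iteratedDeriv_coshQuot (b : ℝ) (n : ℕ) {x : ℂ}
    (hx : 1 + x ^ 2 ∈ Complex.slitPlane) :
    HasDerivAt (iteratedDeriv n (coshQuot b)) (iteratedDeriv (n + 1) (coshQuot b) x) x := by
  rw [iteratedDeriv_succ, iteratedDeriv_eq_iterate]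
  exact ((analyticAt_coshQuot b hx).iterated_deriv n).differentiableAt.hasDerivAt

/-- The differential equation of `coshQuot b`, differentiated `n` times. -/
theorem coshQuot_ode (b : ℝ) (n : ℕ) {x : ℂ} (hx : 1 + x ^ 2 ∈ Complex.slitPlane) :
    (1 + x ^ 2) * iteratedDeriv (n + 2) (coshQuot b) x +
      (2 * n + 3) * x * iteratedDeriv (n + 1) (coshQuot b) x +
      ((n + 1) ^ 2 - b ^ 2) * iteratedDeriv n (coshQuot b) x = 0 := by
  induction n generalizing x with
  | zero =>
    have h0 := sqrtOneAddSq_ne_zero hx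
    have hsq := sqrtOneAddSq_sq x
    have h2 : iteratedDeriv 2 (coshQuot b) x =
        b ^ 2 * Complex.cosh (b * arsinh x) / sqrtOneAddSq x ^ 3 -
          3 * b * x * Complex.sinh (b * arsinh x) / sqrtOneAddSq x ^ 4 -
          Complex.cosh (b * arsinh x) / sqrtOneAddSq x ^ 3 +
          3 * x ^ 2 * Complex.cosh (b * arsinh x) / sqrtOneAddSq x ^ 5 := by
      refine (hasDerivAt_iteratedDeriv_coshQuot b 1 hx).unique ?_
      have hE := hasDerivAt_sqrtOneAddSq hx
      have hd := (((hasDerivAt_sinh_mul_arsinh b hx).const_mul (b : ℂ)).fun_div (hE.fun_pow 2)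
        (pow_ne_zero 2 h0)).fun_sub (((hasDerivAt_id x).fun_mul
        (hasDerivAt_cosh_mul_arsinh b hx)).fun_div (hE.fun_pow 3) (pow_ne_zero 3 h0))
      refine (hd.congr_deriv ?_).congr_of_eventuallyEq ?_
      · simp only [id]
        field_simp
        ring
      · filter_upwards [isOpen_arsinh_domain.mem_nhds hx] with y hy
        exact iteratedDeriv_one_coshQuot b hy
    rw [zero_add, h2, zero_add, iteratedDeriv_one_coshQuot b hx, iteratedDeriv_zero, coshQuot,
      ← hsq]
    field_simp
    push_cast
    ring
  | succ n ih =>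
    -- The equation of order n holds on an open set, so differentiating it gives the next one.
    have h0 : (fun y => (1 + y ^ 2) * iteratedDeriv (n + 2) (coshQuot b) y +
        (2 * n + 3) * y * iteratedDeriv (n + 1) (coshQuot b) y +
        ((n + 1) ^ 2 - b ^ 2) * iteratedDeriv n (coshQuot b) y) =ᶠ[𝓝 x] fun _ => 0 := by
      filter_upwards [isOpen_arsinh_domain.mem_nhds hx] with y hy using ih hy
    have h1 : HasDerivAt (fun x : ℂ => 1 + x ^ 2) (2 * x) x := by
      simpa using (hasDerivAt_pow 2 x).const_add (1 : ℂ)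
    have h2 := ((h1.fun_mul (hasDerivAt_iteratedDeriv_coshQuot b (n + 2) hx)).fun_add
      (((hasDerivAt_id x).const_mul (2 * n + 3 : ℂ)).fun_mul
        (hasDerivAt_iteratedDeriv_coshQuot b (n + 1) hx))).fun_add
      ((hasDerivAt_iteratedDeriv_coshQuot b n hx).const_mul ((n + 1) ^ 2 - b ^ 2 : ℂ))
    have h3 := h2.unique ((hasDerivAt_const x (0 : ℂ)).congr_of_eventuallyEq h0)
    simp only [id] at h3
    push_cast
    rw [← h3]
    ring

/-- The `2m`-th Taylor coefficient of `coshQuot b` at `0`. -/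
noncomputable def coshQuotCoeff (b : ℝ) (m : ℕ) : ℂ :=
  iteratedDeriv (2 * m) (coshQuot b) 0 / (2 * m).factorial

/-- At x = 0 the first-order term of the equation drops out, so only the derivatives of orders n and
n + 2 are linked. -/
theorem iteratedDeriv_add_two_coshQuot_zero (b : ℝ) (n : ℕ) :
    iteratedDeriv (n + 2) (coshQuot b) 0 =
      -((n + 1) ^ 2 - b ^ 2) * iteratedDeriv n (coshQuot b) 0 := by
  have := coshQuot_ode b n zero_mem_arsinh_domain
  linear_combination this

theorem iteratedDeriv_odd_coshQuot_zero (b : ℝ) (m : ℕ) :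
    iteratedDeriv (2 * m + 1) (coshQuot b) 0 = 0 := by
  induction m with
  | zero =>
    rw [mul_zero, zero_add, iteratedDeriv_one_coshQuot b zero_mem_arsinh_domain]
    simp [arsinh_zero]
  | succ m ih =>
    rw [show 2 * (m + 1) + 1 = 2 * m + 1 + 2 by ring, iteratedDeriv_add_two_coshQuot_zero, ih,
      mul_zero]

theorem coshQuotCoeff_zero (b : ℝ) : coshQuotCoeff b 0 = 1 := by
  simp [coshQuotCoeff, coshQuot, arsinh_zero, sqrtOneAddSq_zero]

theorem coshQuotCoeff_succ (b : ℝ) (m : ℕ) :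
    coshQuotCoeff b (m + 1) =
      -((2 * m + 1) ^ 2 - b ^ 2) / ((2 * m + 2) * (2 * m + 1)) * coshQuotCoeff b m := by
  have h : ((2 * m).factorial : ℂ) ≠ 0 := by exact_mod_cast (2 * m).factorial_ne_zero
  have h1 : (2 * m + 1 : ℂ) ≠ 0 := by exact_mod_cast (2 * m).succ_ne_zero
  have h2 : (2 * m + 2 : ℂ) ≠ 0 := by exact_mod_cast (2 * m + 1).succ_ne_zero
  have h3 : (2 * m + 1 + 1 : ℂ) ≠ 0 := by exact_mod_cast (2 * m + 1).succ_ne_zero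
  rw [coshQuotCoeff, show 2 * (m + 1) = 2 * m + 1 + 1 by ring, iteratedDeriv_add_two_coshQuot_zero,
    coshQuotCoeff, Nat.factorial_succ, Nat.factorial_succ]
  push_cast
  field_simp
  ring

/-- Taylor's formula at `0` for the even function `coshQuot b`. -/
theorem coshQuot_sub_isBigO (b : ℝ) (N : ℕ) :
    (fun x => coshQuot b x - ∑ m ∈ Finset.range N, coshQuotCoeff b m * x ^ (2 * m))
      =O[𝓝 0] fun x => ‖x‖ ^ (2 * N) := by
  have h := (analyticAt_coshQuot b zero_mem_arsinh_domain).hasFPowerSeriesAt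
    |>.isBigO_sub_partialSum_pow (2 * N)
  refine h.congr_left fun x => ?_
  rw [zero_add]
  congr 1
  clear h
  rw [FormalMultilinearSeries.partialSum]
  induction N with
  | zero => simp
  | succ N ih =>
    rw [show 2 * (N + 1) = 2 * N + 1 + 1 by ring, Finset.sum_range_succ, Finset.sum_range_succ, ih,
      Finset.sum_range_succ]
    simp [iteratedDeriv_odd_coshQuot_zero, coshQuotCoeff, mul_comm (x ^ _)]

theorem norm_coshQuot_le {b : ℝ} (hb : |b| ≤ 2) {δ : ℝ} (hδ0 : 0 < δ) (hδ1 : δ ≤ 1) {x : ℂ}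
    (hx : δ * ‖x‖ ≤ |x.re|) : ‖coshQuot b x‖ ≤ 2 / δ * (2 * ‖x‖ + 1) ^ 2 := by
  have h1 := norm_cosh_mul_arsinh_le hb x
  have h2 := le_norm_sqrtOneAddSq hδ0.le hδ1 hx
  rw [coshQuot, norm_div, div_le_iff₀ (by linarith)]
  calc ‖Complex.cosh (b * arsinh x)‖ ≤ (2 * ‖x‖ + 1) ^ 2 := h1
    _ = 2 / δ * (2 * ‖x‖ + 1) ^ 2 * (δ / 2) := by field_simp
    _ ≤ _ := by gcongr

/-- The Taylor remainder of `coshQuot b` in a sector. -/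
theorem exists_norm_coshQuot_sub_le {b : ℝ} (hb : |b| ≤ 2) (N : ℕ) {δ : ℝ} (hδ0 : 0 < δ)
    (hδ1 : δ ≤ 1) :
    ∃ C, 0 ≤ C ∧ ∀ x : ℂ, δ * ‖x‖ ≤ |x.re| →
      ‖coshQuot b x - ∑ m ∈ Finset.range N, coshQuotCoeff b m * x ^ (2 * m)‖ ≤
        C * ‖x‖ ^ (2 * N) * (2 * ‖x‖ + 1) ^ 2 := by
  obtain ⟨K, hK⟩ := (coshQuot_sub_isBigO b N).bound
  obtain ⟨ρ, hρ, hball⟩ := Metric.eventually_nhds_iff.1 hK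
  -- For |x| ≥ ρ one has |x|/ρ ≥ 1, so the crude bound on the function and every Taylor term can be
  -- padded up to |x|^{2N}; `L` collects the constants.
  set L := 2 / δ * ρ⁻¹ ^ (2 * N) +
    ∑ m ∈ Finset.range N, ‖coshQuotCoeff b m‖ * ρ⁻¹ ^ (2 * N - 2 * m) with hL
  have hL0 : 0 ≤ L := by positivity
  refine ⟨max (max K L) 0, le_max_right _ _, fun x hx => ?_⟩
  have hone : 1 ≤ (2 * ‖x‖ + 1) ^ 2 := one_le_pow₀ (by linarith [norm_nonneg x])
  rcases lt_or_ge ‖x‖ ρ with h | h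
  · have h1 := hball (by simpa using h)
    rw [Real.norm_of_nonneg (by positivity)] at h1
    calc _ ≤ K * ‖x‖ ^ (2 * N) := h1
      _ ≤ max (max K L) 0 * ‖x‖ ^ (2 * N) := by
        gcongr; exact (le_max_left _ _).trans (le_max_left _ _)
      _ ≤ _ := le_mul_of_one_le_right (by positivity) hone
  · have hx1 : 1 ≤ ρ⁻¹ * ‖x‖ := by rwa [inv_mul_eq_div, one_le_div hρ]
    have h1 : ‖coshQuot b x‖ ≤ 2 / δ * ρ⁻¹ ^ (2 * N) * ‖x‖ ^ (2 * N) * (2 * ‖x‖ + 1) ^ 2 := by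
      refine (norm_coshQuot_le hb hδ0 hδ1 hx).trans ?_
      gcongr
      rw [mul_assoc, ← mul_pow]
      exact le_mul_of_one_le_right (by positivity) (one_le_pow₀ hx1)
    have h2 : ‖∑ m ∈ Finset.range N, coshQuotCoeff b m * x ^ (2 * m)‖ ≤
        (∑ m ∈ Finset.range N, ‖coshQuotCoeff b m‖ * ρ⁻¹ ^ (2 * N - 2 * m)) * ‖x‖ ^ (2 * N) *
          (2 * ‖x‖ + 1) ^ 2 := by
      refine le_trans ?_ (le_mul_of_one_le_right (by positivity) hone)
      rw [Finset.sum_mul]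
      refine norm_sum_le_of_le _ fun m hm => ?_
      have hm' : 2 * m ≤ 2 * N := by have := Finset.mem_range.1 hm; omega
      rw [norm_mul, norm_pow, mul_assoc]
      gcongr
      calc ‖x‖ ^ (2 * m) ≤ (ρ⁻¹ * ‖x‖) ^ (2 * N - 2 * m) * ‖x‖ ^ (2 * m) :=
            le_mul_of_one_le_left (by positivity) (one_le_pow₀ hx1)
        _ = ρ⁻¹ ^ (2 * N - 2 * m) * ‖x‖ ^ (2 * N) := by
            rw [mul_pow, mul_assoc, ← pow_add, Nat.sub_add_cancel hm']
    calc _ ≤ _ := norm_sub_le _ _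
      _ ≤ L * ‖x‖ ^ (2 * N) * (2 * ‖x‖ + 1) ^ 2 := by
        rw [hL, add_mul, add_mul]; exact add_le_add h1 h2
      _ ≤ _ := by gcongr; exact (le_max_right _ _).trans (le_max_left _ _)

/-! #### Gaussian moments -/

theorem integrable_pow_mul_exp_neg_sq (n : ℕ) :
    Integrable fun y : ℝ => y ^ n * Real.exp (-y ^ 2) := by
  have := integrable_rpow_mul_exp_neg_mul_sq one_pos (s := n)
    (by linarith [(Nat.cast_nonneg n : (0 : ℝ) ≤ n)])
  simpa using this

theorem integral_pow_mul_exp_neg_sq (m : ℕ) :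
    ∫ y : ℝ in Set.Ioi 0, y ^ (2 * m) * Real.exp (-y ^ 2) = Real.Gamma (m + 1 / 2) / 2 := by
  have := integral_rpow_mul_exp_neg_rpow two_pos (q := (2 * m : ℕ))
    (by linarith [(Nat.cast_nonneg (2 * m) : (0 : ℝ) ≤ (2 * m : ℕ))])
  simp only [Real.rpow_natCast, Real.rpow_two] at this
  rw [this, show (((2 * m : ℕ) : ℝ) + 1) / 2 = m + 1 / 2 by push_cast; ring]
  ring

/-- The Gaussian average of the `m`-th Taylor term of `coshQuot b`. -/
noncomputable def gaussCoeff (b : ℝ) (m : ℕ) : ℂ :=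
  coshQuotCoeff b m * ((Real.Gamma (m + 1 / 2) / 2 : ℝ) : ℂ)

theorem gaussCoeff_zero (b : ℝ) : gaussCoeff b 0 = ((√Real.pi / 2 : ℝ) : ℂ) := by
  rw [gaussCoeff, coshQuotCoeff_zero, Nat.cast_zero, zero_add, Real.Gamma_one_half_eq, one_mul]

/-- The factor m + 1/2 in Γ(m + 3/2) = (m + 1/2) Γ(m + 1/2) cancels the 2m + 1 in the denominator of
the Taylor recurrence. -/
theorem gaussCoeff_succ (b : ℝ) (m : ℕ) :
    gaussCoeff b (m + 1) =
      -((2 * m + 1) ^ 2 - b ^ 2) / (4 * (m + 1)) * gaussCoeff b m := by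
  have h1 : (2 * m + 1 : ℂ) ≠ 0 := by exact_mod_cast (2 * m).succ_ne_zero
  have h2 : (m + 1 : ℂ) ≠ 0 := by exact_mod_cast m.succ_ne_zero
  have h3 : (2 * m + 2 : ℂ) ≠ 0 := by exact_mod_cast (2 * m + 1).succ_ne_zero
  rw [gaussCoeff, gaussCoeff, coshQuotCoeff_succ, show ((m + 1 : ℕ) : ℝ) + 1 / 2 = m + 1 / 2 + 1 by
    push_cast; ring, Real.Gamma_add_one (by positivity)]
  push_cast
  field_simp
  ring

theorem continuous_coshQuot_ray (b : ℝ) {v : ℂ} (hv : v.re ≠ 0) :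
    Continuous fun y : ℝ => coshQuot b (v * y) :=
  continuous_iff_continuousAt.2 fun y => ContinuousAt.comp (f := fun y : ℝ => v * (y : ℂ))
    (analyticAt_coshQuot b (mem_arsinh_domain_of_re_ne_zero hv y)).continuousAt (by fun_prop)

/-- The asymptotic expansion of the Gaussian average of `coshQuot b`. -/
theorem exists_norm_gaussAverage_sub_le {b : ℝ} (hb : |b| ≤ 2) (N : ℕ) {δ : ℝ} (hδ0 : 0 < δ)
    (hδ1 : δ ≤ 1) :
    ∃ C, 0 ≤ C ∧ ∀ v : ℂ, v.re ≠ 0 → ‖v‖ ≤ 1 → δ * ‖v‖ ≤ |v.re| →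
      ‖(∫ y : ℝ in Set.Ioi 0, coshQuot b (v * y) * Real.exp (-y ^ 2)) -
        ∑ m ∈ Finset.range N, gaussCoeff b m * v ^ (2 * m)‖ ≤ C * ‖v‖ ^ (2 * N) := by
  obtain ⟨C, hC0, hC⟩ := exists_norm_coshQuot_sub_le hb N hδ0 hδ1
  -- This is y^{2N} (2y+1)² e^{-y²} expanded: the remainder bound at vy with |v|^{2N} taken out and
  -- |v| ≤ 1 used in the last factor.
  set g : ℝ → ℝ := fun y => 4 * (y ^ (2 * N + 2) * Real.exp (-y ^ 2)) +
    4 * (y ^ (2 * N + 1) * Real.exp (-y ^ 2)) + y ^ (2 * N) * Real.exp (-y ^ 2) with hg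
  have hgi : Integrable g := (((integrable_pow_mul_exp_neg_sq _).const_mul 4).add
    ((integrable_pow_mul_exp_neg_sq _).const_mul 4)).add (integrable_pow_mul_exp_neg_sq _)
  have hg0 : ∀ y ∈ Set.Ioi (0 : ℝ), 0 ≤ g y := fun y hy => by
    have : 0 < y := hy
    simp only [hg]; positivity
  refine ⟨C * ∫ y in Set.Ioi 0, g y, mul_nonneg hC0 (setIntegral_nonneg measurableSet_Ioi hg0),
    fun v hv hv1 hδv => ?_⟩
  set P : ℝ → ℂ := fun y => ∑ m ∈ Finset.range N,
    coshQuotCoeff b m * v ^ (2 * m) * ((y ^ (2 * m) * Real.exp (-y ^ 2) : ℝ) : ℂ) with hP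
  have hterm : ∀ m, Integrable fun y : ℝ =>
      coshQuotCoeff b m * v ^ (2 * m) * ((y ^ (2 * m) * Real.exp (-y ^ 2) : ℝ) : ℂ) := fun m =>
    (integrable_pow_mul_exp_neg_sq (2 * m)).ofReal.const_mul _
  have hPi : Integrable P := integrable_finsetSum _ fun m _ => hterm m
  have hPint : ∫ y in Set.Ioi 0, P y = ∑ m ∈ Finset.range N, gaussCoeff b m * v ^ (2 * m) := by
    simp only [hP]
    rw [integral_finsetSum _ fun m _ => (hterm m).integrableOn]
    refine Finset.sum_congr rfl fun m _ => ?_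
    rw [integral_const_mul, integral_complex_ofReal, integral_pow_mul_exp_neg_sq, gaussCoeff]
    ring
  have hbound : ∀ y ∈ Set.Ioi (0 : ℝ), ‖coshQuot b (v * y) * Real.exp (-y ^ 2) - P y‖ ≤
      C * ‖v‖ ^ (2 * N) * g y := by
    intro y hy
    have hy0 : 0 < y := hy
    have hn : ‖v * y‖ = ‖v‖ * y := by rw [norm_mul, Complex.norm_real, Real.norm_of_nonneg hy0.le]
    have hx : δ * ‖v * y‖ ≤ |(v * y).re| := by
      rw [hn, Complex.re_mul_ofReal, abs_mul, abs_of_pos hy0, ← mul_assoc]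
      gcongr
    have h1 : coshQuot b (v * y) * Real.exp (-y ^ 2) - P y = (coshQuot b (v * y) -
        ∑ m ∈ Finset.range N, coshQuotCoeff b m * (v * y) ^ (2 * m)) * Real.exp (-y ^ 2) := by
      rw [sub_mul, Finset.sum_mul]
      congr 1
      refine Finset.sum_congr rfl fun m _ => ?_
      push_cast; ring
    rw [h1, norm_mul, Complex.norm_real, Real.norm_of_nonneg (Real.exp_pos _).le]
    calc _ ≤ C * ‖v * y‖ ^ (2 * N) * (2 * ‖v * y‖ + 1) ^ 2 * Real.exp (-y ^ 2) := by
          gcongr; exact hC _ hx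
      _ = C * ‖v‖ ^ (2 * N) * (y ^ (2 * N) * (2 * (‖v‖ * y) + 1) ^ 2 * Real.exp (-y ^ 2)) := by
          rw [hn]; ring
      _ ≤ C * ‖v‖ ^ (2 * N) * (y ^ (2 * N) * (2 * (1 * y) + 1) ^ 2 * Real.exp (-y ^ 2)) := by
          gcongr
      _ = _ := by simp only [hg]; ring
  have hmeas : Continuous fun y : ℝ => coshQuot b (v * y) * Real.exp (-y ^ 2) :=
    (continuous_coshQuot_ray b hv).mul (by fun_prop)
  have hdom : IntegrableOn (fun y => C * ‖v‖ ^ (2 * N) * g y) (Set.Ioi 0) :=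
    (hgi.const_mul _).integrableOn
  have hdiff : IntegrableOn (fun y : ℝ => coshQuot b (v * y) * Real.exp (-y ^ 2) - P y)
      (Set.Ioi 0) :=
    Integrable.mono' hdom (hmeas.aestronglyMeasurable.sub hPi.aestronglyMeasurable).restrict
      ((ae_restrict_iff' measurableSet_Ioi).2 (Eventually.of_forall hbound))
  have hint : IntegrableOn (fun y : ℝ => coshQuot b (v * y) * Real.exp (-y ^ 2)) (Set.Ioi 0) := by
    have := hdiff.add hPi.integrableOn
    refine this.congr_fun (fun y _ => ?_) measurableSet_Ioi
    simp
  rw [← hPint, ← integral_sub hint hPi.integrableOn, mul_right_comm]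
  calc _ ≤ ∫ y in Set.Ioi 0, C * ‖v‖ ^ (2 * N) * g y :=
        norm_integral_le_of_norm_le hdom
          ((ae_restrict_iff' measurableSet_Ioi).2 (Eventually.of_forall hbound))
    _ = _ := by rw [integral_const_mul]

/-! ### Lucas polynomials in the hyperbolic parametrisation -/

theorem differentiable_lucasV (n : ℕ) (t : ℂ) : Differentiable ℂ fun w => lucasV n w t := by
  induction n using Nat.twoStepInduction with
  | zero => simp [lucasV]
  | one => simp [lucasV]
  | more n ih1 ih2 =>
    simp only [lucasV]
    exact (differentiable_id.mul ih2).sub (ih1.const_mul t)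

/-- The recurrence is the addition formula for cosh((n+1)s ± s). -/
theorem lucasV_cosh (n : ℕ) (ρ s : ℂ) :
    lucasV n (2 * ρ * Complex.cosh s) (ρ ^ 2) = 2 * ρ ^ n * Complex.cosh (n * s) := by
  induction n using Nat.twoStepInduction with
  | zero => simp [lucasV]
  | one => simp [lucasV]
  | more n ih1 ih2 =>
    simp only [lucasV]
    rw [ih1, ih2]
    have h1 : Complex.cosh ((n + 2 : ℕ) * s) = Complex.cosh ((n + 1 : ℕ) * s) * Complex.cosh s +
        Complex.sinh ((n + 1 : ℕ) * s) * Complex.sinh s := by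
      rw [← Complex.cosh_add]; push_cast; ring_nf
    have h2 : Complex.cosh (n * s) = Complex.cosh ((n + 1 : ℕ) * s) * Complex.cosh s -
        Complex.sinh ((n + 1 : ℕ) * s) * Complex.sinh s := by
      rw [← Complex.cosh_sub]; push_cast; ring_nf
    rw [h1, h2]
    ring

/-- Multiplying by sinh s avoids a division at its zeros, and sinh s is the factor that dw provides.
-/
theorem lucasU_cosh_mul_sinh (n : ℕ) (ρ s : ℂ) :
    lucasU (n + 1) (2 * ρ * Complex.cosh s) (ρ ^ 2) * Complex.sinh s =
      ρ ^ n * Complex.sinh ((n + 1) * s) := by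
  induction n using Nat.twoStepInduction with
  | zero => simp [lucasU]
  | one =>
    simp only [lucasU]
    push_cast
    rw [one_add_one_eq_two, Complex.sinh_two_mul]
    ring
  | more n ih1 ih2 =>
    have h0 : lucasU (n + 2 + 1) (2 * ρ * Complex.cosh s) (ρ ^ 2) =
      2 * ρ * Complex.cosh s * lucasU (n + 1 + 1) (2 * ρ * Complex.cosh s) (ρ ^ 2) -
        ρ ^ 2 * lucasU (n + 1) (2 * ρ * Complex.cosh s) (ρ ^ 2) := rfl
    have h1 : Complex.sinh (((n + 2 : ℕ) + 1) * s) =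
        Complex.sinh (((n + 1 : ℕ) + 1) * s) * Complex.cosh s +
        Complex.cosh (((n + 1 : ℕ) + 1) * s) * Complex.sinh s := by
      rw [← Complex.sinh_add]; push_cast; ring_nf
    have h2 : Complex.sinh ((n + 1) * s) =
        Complex.sinh (((n + 1 : ℕ) + 1) * s) * Complex.cosh s -
        Complex.cosh (((n + 1 : ℕ) + 1) * s) * Complex.sinh s := by
      rw [← Complex.sinh_sub]; push_cast; ring_nf
    rw [h2] at ih1
    rw [h0, h1, sub_mul]
    linear_combination 2 * ρ * Complex.cosh s * ih2 - ρ ^ 2 * ih1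

/-! ### The phase function -/

theorem tpow_add (ℓ s s' : ℂ) : tpow ℓ (s + s') = tpow ℓ s * tpow ℓ s' := by
  rw [tpow, tpow, tpow, ← Complex.exp_add, add_mul]

theorem tpow_pow (ℓ s : ℂ) (n : ℕ) : tpow ℓ s ^ n = tpow ℓ (n * s) := by
  rw [tpow, tpow, ← Complex.exp_nat_mul, mul_assoc]

theorem tpow_ne_zero (ℓ s : ℂ) : tpow ℓ s ≠ 0 := Complex.exp_ne_zero _

theorem tpow_half_sq (ℓ : ℂ) : tpow ℓ (1 / 2) ^ 2 = Complex.exp ℓ := by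
  rw [tpow_pow, tpow]; congr 1; push_cast; ring

theorem tpow_half_pow (ℓ : ℂ) (n : ℕ) : tpow ℓ (1 / 2) ^ n = tpow ℓ (n / 2) := by
  rw [tpow_pow]; congr 1; ring

theorem sqrtSign_sq (j : ℕ) : sqrtSign j ^ 2 = (-1) ^ j := by
  unfold sqrtSign
  split_ifs with h
  · rw [Complex.I_sq, h.neg_one_pow]
  · rw [one_pow, (Nat.not_odd_iff_even.1 h).neg_one_pow]

theorem norm_sqrtSign (j : ℕ) : ‖sqrtSign j‖ = 1 := by
  unfold sqrtSign
  split_ifs <;> simp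

theorem sqrtSign_ne_zero (j : ℕ) : sqrtSign j ≠ 0 := by
  rw [← norm_ne_zero_iff, norm_sqrtSign]; exact one_ne_zero

theorem differentiable_phase (r : ℕ) (ℓ : ℂ) : Differentiable ℂ (phase r ℓ) :=
  (differentiable_lucasV r _).div_const _

theorem phase_cosh (r : ℕ) (ℓ s : ℂ) :
    phase r ℓ (2 * tpow ℓ (1 / 2) * Complex.cosh s) =
      2 / r * tpow ℓ (r / 2) * Complex.cosh (r * s) := by
  rw [phase, ← tpow_half_sq, lucasV_cosh, tpow_half_pow]
  ring

theorem phase_cos (r : ℕ) (ℓ θ : ℂ) :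
    phase r ℓ (2 * tpow ℓ (1 / 2) * Complex.cos θ) =
      2 / r * tpow ℓ (r / 2) * Complex.cos (r * θ) := by
  rw [← Complex.cosh_mul_I, phase_cosh, ← Complex.cosh_mul_I, mul_assoc (r : ℂ)]

theorem cosh_natCast_mul_pi_mul_I_add (j : ℕ) (x : ℂ) :
    Complex.cosh (j * Real.pi * Complex.I + x) = (-1) ^ j * Complex.cosh x := by
  rw [Complex.cosh_add, Complex.cosh_mul_I, Complex.sinh_mul_I, Complex.sin_nat_mul_pi,
    ← Complex.ofReal_natCast, ← Complex.ofReal_mul, ← Complex.ofReal_cos, Real.cos_nat_mul_pi]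
  push_cast
  ring

theorem phase_critPt {r : ℕ} (hr : r ≠ 0) (j : ℕ) (ℓ : ℂ) :
    phase r ℓ (critPt r j ℓ) = (-1) ^ j * (2 / r) * tpow ℓ (r / 2) := by
  have hr' : (r : ℂ) ≠ 0 := by exact_mod_cast hr
  have h1 : (r : ℂ) * ((j * Real.pi / r : ℝ) : ℂ) * Complex.I = j * Real.pi * Complex.I + 0 := by
    push_cast; field_simp; ring
  rw [critPt, Complex.ofReal_cos, phase_cos, ← Complex.cosh_mul_I, h1,
    cosh_natCast_mul_pi_mul_I_add, Complex.cosh_zero]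
  ring

/-! ### The descent curve through a critical point -/

/-- The factor `v` such that `2 √t cosh (i j π / r + (2 / r) arsinh (v y))` descends as `-y ^ 2`
along the thimble. -/
noncomputable def thimbleScale (r j : ℕ) (ℓ : ℂ) : ℂ :=
  -Complex.I * sqrtSign j * ((√r / 2 : ℝ) : ℂ) * tpow ℓ (-r / 4)

/-- Up to the factor 4 this is the argument at which `B` is evaluated. -/
theorem thimbleScale_sq (r j : ℕ) (ℓ : ℂ) :
    thimbleScale r j ℓ ^ 2 = (-1) ^ (j + 1) * r * tpow ℓ (-r / 2) / 4 := by
  have h1 : ((√r / 2 : ℝ) : ℂ) ^ 2 = r / 4 := by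
    rw [← Complex.ofReal_pow, div_pow, Real.sq_sqrt (Nat.cast_nonneg r)]; push_cast; norm_num
  rw [thimbleScale, mul_pow, mul_pow, mul_pow, neg_sq, Complex.I_sq, sqrtSign_sq, h1, tpow_pow,
    show ((2 : ℕ) : ℂ) * (-r / 4) = -r / 2 by push_cast; ring]
  ring

theorem thimbleScale_ne_zero {r : ℕ} (hr : 0 < r) (j : ℕ) (ℓ : ℂ) : thimbleScale r j ℓ ≠ 0 := by
  have h : (√r / 2 : ℝ) ≠ 0 := by positivity
  exact mul_ne_zero (mul_ne_zero (mul_ne_zero (neg_ne_zero.2 Complex.I_ne_zero)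
    (sqrtSign_ne_zero j)) (Complex.ofReal_ne_zero.2 h)) (tpow_ne_zero _ _)

theorem thimbleScale_sq_mul {r : ℕ} (hr : 0 < r) (j : ℕ) (ℓ : ℂ) :
    2 * thimbleScale r j ℓ ^ 2 * ((-1) ^ j * (2 / r) * tpow ℓ (r / 2)) = -1 := by
  have hr' : (r : ℂ) ≠ 0 := by exact_mod_cast hr.ne'
  have h1 : tpow ℓ (-r / 2) * tpow ℓ (r / 2) = 1 := by
    rw [← tpow_add, tpow]; simp [neg_div]
  have h2 : ((-1 : ℂ) ^ j) ^ 2 = 1 := by rw [← pow_mul, mul_comm, pow_mul, neg_one_sq, one_pow]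
  rw [thimbleScale_sq, pow_succ]
  generalize tpow ℓ (-r / 2) = x at *
  generalize tpow ℓ (r / 2) = y at *
  field_simp
  linear_combination -4 * (x * y) * h2 - 4 * h1

/-- The argument of the hyperbolic cosine along the thimble. -/
noncomputable def thimbleArg (r j : ℕ) (ℓ y : ℂ) : ℂ :=
  j * Real.pi / r * Complex.I + 2 / r * arsinh (thimbleScale r j ℓ * y)

/-- The thimble parametrised by the square root of the descent of the phase. -/
noncomputable def thimbleCurve (r j : ℕ) (ℓ y : ℂ) : ℂ :=
  2 * tpow ℓ (1 / 2) * Complex.cosh (thimbleArg r j ℓ y)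

/-- With x = vy, r times the hyperbolic argument is ijπ + 2 arsinh x, so the phase is f(w_j)(1 +
2x²); v is normalised by 2v² f(w_j) = -1. -/
theorem phase_thimbleCurve {r : ℕ} (hr : 0 < r) (j : ℕ) (ℓ y : ℂ) :
    phase r ℓ (thimbleCurve r j ℓ y) = phase r ℓ (critPt r j ℓ) - y ^ 2 := by
  have hr' : (r : ℂ) ≠ 0 := by exact_mod_cast hr.ne'
  have h1 : (r : ℂ) * thimbleArg r j ℓ y =
      j * Real.pi * Complex.I + 2 * arsinh (thimbleScale r j ℓ * y) := by
    rw [thimbleArg]; field_simp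
  have h2 : Complex.cosh (2 * arsinh (thimbleScale r j ℓ * y)) =
      1 + 2 * (thimbleScale r j ℓ * y) ^ 2 := by
    rw [Complex.cosh_two_mul, Complex.cosh_sq, sinh_arsinh]; ring
  rw [thimbleCurve, phase_cosh, h1, cosh_natCast_mul_pi_mul_I_add, h2, phase_critPt hr.ne']
  linear_combination y ^ 2 * thimbleScale_sq_mul hr j ℓ

theorem hasDerivAt_thimbleCurve {r j : ℕ} {ℓ y : ℂ}
    (hy : 1 + (thimbleScale r j ℓ * y) ^ 2 ∈ Complex.slitPlane) :
    HasDerivAt (thimbleCurve r j ℓ) (2 * tpow ℓ (1 / 2) * (Complex.sinh (thimbleArg r j ℓ y) *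
      (2 / r * (thimbleScale r j ℓ / sqrtOneAddSq (thimbleScale r j ℓ * y))))) y := by
  have h1 : HasDerivAt (fun y => thimbleScale r j ℓ * y) (thimbleScale r j ℓ) y := by
    simpa using (hasDerivAt_id y).const_mul (thimbleScale r j ℓ)
  have h2 := (((hasDerivAt_arsinh hy).comp y h1).const_mul (2 / r : ℂ)).const_add
    (j * Real.pi / r * Complex.I : ℂ)
  refine (h2.ccosh.const_mul (2 * tpow ℓ (1 / 2))).congr_deriv ?_
  simp only [thimbleArg, Function.comp_apply]
  ring

theorem thimbleArg_zero (r j : ℕ) (ℓ : ℂ) :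
    thimbleArg r j ℓ 0 = ((j * Real.pi / r : ℝ) : ℂ) * Complex.I := by
  rw [thimbleArg, mul_zero, arsinh_zero, mul_zero, add_zero]
  push_cast
  rfl

theorem sin_natCast_mul_pi_div_pos {r k : ℕ} (hk : 1 ≤ k) (hkr : k + 1 ≤ r) :
    0 < Real.sin (k * Real.pi / r) := by
  have hr : (0 : ℝ) < r := by exact_mod_cast (by omega : 0 < r)
  have hk' : (0 : ℝ) < k := by exact_mod_cast hk
  refine Real.sin_pos_of_pos_of_lt_pi (by positivity) ?_
  rw [div_lt_iff₀ hr, mul_comm]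
  have : (k : ℝ) < r := by exact_mod_cast hkr
  gcongr

/-- The -i in `thimbleScale` cancels the i of sinh(iθ) = i sin θ. As sin(jπ/r) > 0 for 0 < j < r,
the tangent then has the prescribed orientation. -/
theorem deriv_thimbleCurve_zero {r j : ℕ} (hr : 0 < r) (ℓ : ℂ) :
    deriv (thimbleCurve r j ℓ) 0 = ((2 * Real.sin (j * Real.pi / r) / √r : ℝ) : ℂ) *
      (sqrtSign j * tpow ℓ ((2 - r) / 4)) := by
  have h0 : 1 + (thimbleScale r j ℓ * 0) ^ 2 ∈ Complex.slitPlane := by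
    simp [Complex.one_mem_slitPlane]
  have hr' : ((√r : ℝ) : ℂ) ≠ 0 := by
    rw [Complex.ofReal_ne_zero]; positivity
  have hrr : (r : ℂ) = ((√r : ℝ) : ℂ) ^ 2 := by
    rw [← Complex.ofReal_pow, Real.sq_sqrt (Nat.cast_nonneg r)]; simp
  rw [(hasDerivAt_thimbleCurve h0).deriv, thimbleArg_zero, mul_zero, sqrtOneAddSq_zero,
    Complex.sinh_mul_I, thimbleScale, show ((2 - r) / 4 : ℂ) = 1 / 2 + -r / 4 by ring, tpow_add]
  push_cast
  generalize tpow ℓ (1 / 2) = x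
  generalize tpow ℓ (-r / 4) = x'
  rw [show (2 / (r : ℂ)) = 2 / ((√r : ℝ) : ℂ) ^ 2 by rw [← hrr]]
  field_simp
  linear_combination -Complex.sin (j * Real.pi / r) * x * sqrtSign j * x' * Complex.I_sq

theorem unitVec_deriv_thimbleCurve_zero {r j : ℕ} (hj1 : 1 ≤ j) (hjr : j + 1 ≤ r) (ℓ : ℂ) :
    unitVec (deriv (thimbleCurve r j ℓ) 0) = orientation r j ℓ := by
  have hr : (0 : ℝ) < r := by exact_mod_cast (by omega : 0 < r)
  have h1 : 0 < 2 * Real.sin (j * Real.pi / r) / √r := by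
    have := sin_natCast_mul_pi_div_pos hj1 hjr
    positivity
  rw [deriv_thimbleCurve_zero (by omega), unitVec_pos_mul h1, unitVec, norm_mul, norm_sqrtSign,
    one_mul, orientation, mul_div_assoc]

theorem isDescentCurve_thimbleCurve {r j : ℕ} (hj1 : 1 ≤ j) (hjr : j + 1 ≤ r) {ℓ : ℂ}
    (hv : (thimbleScale r j ℓ).re ≠ 0) :
    IsDescentCurve (phase r ℓ) (critPt r j ℓ) (thimbleCurve r j ℓ) where
  differentiable := differentiable_phase r ℓ
  apply_zero := by
    rw [thimbleCurve, thimbleArg_zero, Complex.cosh_mul_I, critPt, Complex.ofReal_cos]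
  comp_eq y := phase_thimbleCurve (by omega) j ℓ y
  analyticAt y := by
    have hopen : IsOpen {y : ℂ | 1 + (thimbleScale r j ℓ * y) ^ 2 ∈ Complex.slitPlane} :=
      Complex.isOpen_slitPlane.preimage (by fun_prop)
    exact DifferentiableOn.analyticAt (fun _ hy =>
      (hasDerivAt_thimbleCurve hy).differentiableAt.differentiableWithinAt)
      (hopen.mem_nhds (mem_arsinh_domain_of_re_ne_zero hv y))
  deriv_zero := by
    have hr : (0 : ℝ) < r := by exact_mod_cast (by omega : 0 < r)
    have h1 : 0 < 2 * Real.sin (j * Real.pi / r) / √r := by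
      have := sin_natCast_mul_pi_div_pos hj1 hjr
      positivity
    rw [deriv_thimbleCurve_zero (by omega)]
    exact mul_ne_zero (Complex.ofReal_ne_zero.2 h1.ne')
      (mul_ne_zero (sqrtSign_ne_zero j) (tpow_ne_zero _ _))

/-! ### Stokes lines -/

theorem cos_natCast_mul_pi_add (j : ℕ) (x : ℝ) :
    Real.cos (j * Real.pi + x) = (-1) ^ j * Real.cos x := by
  rw [Real.cos_add, Real.cos_nat_mul_pi, Real.sin_nat_mul_pi]; ring

/-- If `(-1) ^ j t ^ (r / 2)` is positive, there is a Stokes line from `w_j` to a neighbouring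
critical point. -/
theorem hasStokesLine_of_pos {r j k : ℕ} (hj1 : 1 ≤ j) (hjr : j + 1 ≤ r) (hk1 : 1 ≤ k)
    (hkr : k + 1 ≤ r) {ε : ℝ} (hε : ε ^ 2 = 1) (hjk : (k : ℝ) = j + ε) {ℓ : ℂ} {κ : ℝ}
    (hκ : 0 < κ) (hpos : (-1) ^ j * (2 / r) * tpow ℓ (r / 2) = (κ : ℂ)) :
    HasStokesLine (phase r ℓ) (critPt r j ℓ) := by
  have hr : (0 : ℝ) < r := by exact_mod_cast (by omega : 0 < r)
  have hrc : (r : ℂ) ≠ 0 := by exact_mod_cast hr.ne'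
  have hρ : 0 < ‖tpow ℓ (1 / 2)‖ := norm_pos_iff.2 (tpow_ne_zero _ _)
  set ρ := tpow ℓ (1 / 2) with hρdef
  -- The angle moves from jπ/r to kπ/r. Since rθ = jπ + 2ε arctan(e^u), the phase at 2ρ cos θ is
  -- κ(2/(1+e^{2u}) - 1), decreasing from κ to -κ.
  set θ : ℝ → ℝ := fun u => j * Real.pi / r + ε * (2 / r) * Real.arctan (Real.exp u) with hθ
  set d : ℝ → ℝ := fun u => ε * (2 / r) * (Real.exp u / (1 + Real.exp u ^ 2)) with hd
  have hε0 : ε ≠ 0 := by rintro rfl; norm_num at hε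
  have hpowsq : ((-1 : ℂ) ^ j) ^ 2 = 1 := by
    rw [← pow_mul, mul_comm, pow_mul, neg_one_sq, one_pow]
  have hθ1 : (k * Real.pi / r : ℝ) = j * Real.pi / r + ε * (2 / r) * (Real.pi / 2) := by
    rw [hjk]; field_simp
  have hθd : ∀ u, HasDerivAt θ (d u) u := fun u => by
    refine (((Real.hasDerivAt_exp u).arctan.const_mul (ε * (2 / r))).const_add _).congr_deriv ?_
    simp only [hd]; ring
  have hθc : Continuous θ := continuous_iff_continuousAt.2 fun u => (hθd u).continuousAt
  have hsj := sin_natCast_mul_pi_div_pos hj1 hjr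
  have hsk := sin_natCast_mul_pi_div_pos hk1 hkr
  set σ := min (Real.sin (j * Real.pi / r)) (Real.sin (k * Real.pi / r)) with hσ
  have hσ0 : 0 < σ := lt_min hsj hsk
  have hmem : ∀ i : ℕ, i + 1 ≤ r → (i * Real.pi / r : ℝ) ∈ Set.Icc 0 Real.pi := fun i hi => by
    refine ⟨by positivity, ?_⟩
    rw [div_le_iff₀ hr, mul_comm]
    have : (i : ℝ) ≤ r := by exact_mod_cast (by omega : i ≤ r)
    gcongr
  -- Concavity of the sine on [0, π] bounds it below by its end values; this bounds the time density
  -- below, so the flow line exists for all times.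
  have hsin : ∀ u, σ ≤ Real.sin (θ u) := by
    intro u
    refine strictConcaveOn_sin_Icc.concaveOn.min_le_of_mem_segment (hmem j hjr) (hmem k hkr) ?_
    have h0 : 0 < Real.arctan (Real.exp u) := by
      simpa using Real.arctan_strictMono (Real.exp_pos u)
    have h1 := (Real.arctan_lt_pi_div_two (Real.exp u)).le
    have hpi := Real.pi_pos
    refine ⟨1 - Real.arctan (Real.exp u) / (Real.pi / 2), Real.arctan (Real.exp u) / (Real.pi / 2),
      sub_nonneg.2 ((div_le_one (by positivity)).2 h1), by positivity, by ring, ?_⟩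
    simp only [smul_eq_mul, hθ]
    rw [hθ1]
    field_simp
    ring
  set c : ℝ → ℂ := fun u => 2 * ρ * ((Real.cos (θ u) : ℝ) : ℂ) with hc
  set c' : ℝ → ℂ := fun u => 2 * ρ * ((-Real.sin (θ u) * d u : ℝ) : ℂ) with hc'
  set q : ℝ → ℝ := fun u => κ * (4 * Real.exp u ^ 2 / (1 + Real.exp u ^ 2) ^ 2) with hq
  -- This is |c'|²/q; the factors e^{2u}/(1+e^{2u})² cancel.
  set R : ℝ → ℝ := fun u => 4 * ‖ρ‖ ^ 2 / (r ^ 2 * κ) * Real.sin (θ u) ^ 2 with hR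
  have hcd : ∀ u, HasDerivAt c (c' u) u := fun u =>
    ((hθd u).cos.ofReal_comp.const_mul (2 * ρ))
  have hfc : ∀ u, phase r ℓ (c u) = ((κ * (2 / (1 + Real.exp u ^ 2) - 1) : ℝ) : ℂ) := by
    intro u
    have h1 : (r : ℝ) * θ u = j * Real.pi + ε * (2 * Real.arctan (Real.exp u)) := by
      simp only [hθ]; field_simp
    have h2 : Real.cos (ε * (2 * Real.arctan (Real.exp u))) =
        2 / (1 + Real.exp u ^ 2) - 1 := by
      have : Real.cos (ε * (2 * Real.arctan (Real.exp u))) =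
          Real.cos (2 * Real.arctan (Real.exp u)) := by
        rcases mul_self_eq_one_iff.1 (sq ε ▸ hε) with h | h <;> simp [h]
      rw [this, Real.cos_two_mul, Real.cos_sq_arctan]
      ring
    simp only [hc]
    rw [Complex.ofReal_cos, phase_cos, ← Complex.ofReal_natCast, ← Complex.ofReal_mul, h1,
      ← Complex.ofReal_cos, cos_natCast_mul_pi_add, h2, Complex.ofReal_mul κ, ← hpos]
    push_cast
    ring
  have hfd : ∀ u, HasDerivAt (fun u => phase r ℓ (c u)) (-(q u : ℂ)) u := by
    intro u
    simp only [hfc]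
    rw [← Complex.ofReal_neg]
    have h0 : (1 + Real.exp u ^ 2) ≠ 0 := by positivity
    have h1 : HasDerivAt (fun u => κ * (2 / (1 + Real.exp u ^ 2) - 1)) (-q u) u := by
      have h2 := (((Real.hasDerivAt_exp u).fun_pow 2).const_add 1)
      refine ((((hasDerivAt_const u (2 : ℝ)).fun_div h2 h0).sub_const 1).const_mul κ).congr_deriv ?_
      simp only [hq]
      field_simp
      ring
    exact h1.ofReal_comp
  have hd0 : ∀ u, d u ≠ 0 := fun u => by
    simp only [hd]
    have := Real.exp_pos u
    positivity
  have hc0 : ∀ u, c' u ≠ 0 := fun u =>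
    mul_ne_zero (mul_ne_zero two_ne_zero (tpow_ne_zero _ _)) (Complex.ofReal_ne_zero.2
      (mul_ne_zero (neg_ne_zero.2 (hσ0.trans_le (hsin u)).ne') (hd0 u)))
  have hRq : ∀ u, R u * q u = ‖c' u‖ ^ 2 := by
    intro u
    simp only [hc', norm_mul, Complex.norm_real, Real.norm_eq_abs, mul_pow, sq_abs, neg_sq,
      Complex.norm_ofNat, hR, hq, hd, hε, one_mul, div_pow]
    field_simp
    ring
  have hRc : Continuous R := ((Real.continuous_sin.comp hθc).pow 2).const_mul _
  have hRlow : ∀ u, 4 * ‖ρ‖ ^ 2 / (r ^ 2 * κ) * σ ^ 2 ≤ R u := fun u => by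
    simp only [hR]
    gcongr
    exact hsin u
  have hlow0 : 0 < 4 * ‖ρ‖ ^ 2 / (r ^ 2 * κ) * σ ^ 2 := by positivity
  obtain ⟨T, Φ, Ψ, ht, -⟩ := exists_isTimeChange hRc (fun u => hlow0.trans_le (hRlow u)) hlow0
    (Eventually.of_forall hRlow) 0 0
  obtain ⟨rfl, htop⟩ := ht.eq_top_and_tendsto_atTop hlow0 hRlow
  have hcos : Continuous fun x : ℝ => 2 * ρ * ((Real.cos x : ℝ) : ℂ) := by fun_prop
  refine ⟨critPt r k ℓ, fun τ => c (Ψ τ), ?_, ?_, ht.isFlowLine (differentiable_phase r ℓ) hcd hfd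
    hc0 hRq, ?_, ?_⟩
  · intro heq
    rw [critPt, critPt, mul_right_inj' (mul_ne_zero two_ne_zero (tpow_ne_zero _ _)),
      Complex.ofReal_inj] at heq
    have h1 := Real.injOn_cos (hmem k hkr) (hmem j hjr) heq
    rw [hθ1] at h1
    have h2 : ε * (2 / r) * (Real.pi / 2) ≠ 0 := by
      have := Real.pi_pos
      positivity
    exact h2 (by linarith)
  -- The derivative of θ ↦ f(2ρ cos θ) vanishes at kπ/r, where sin θ ≠ 0, so f' vanishes at the end
  -- point.
  · set x : ℂ := ((k * Real.pi / r : ℝ) : ℂ) with hx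
    have h1 : HasDerivAt (fun θ => phase r ℓ (2 * ρ * Complex.cos θ))
        (deriv (phase r ℓ) (2 * ρ * Complex.cos x) * (2 * ρ * -Complex.sin x)) x :=
      (differentiable_phase r ℓ _).hasDerivAt.comp x
        ((Complex.hasDerivAt_cos x).const_mul (2 * ρ))
    have h2 : HasDerivAt (fun θ => phase r ℓ (2 * ρ * Complex.cos θ)) 0 x := by
      simp only [hρdef, phase_cos]
      have h3 : HasDerivAt (fun θ : ℂ => (r : ℂ) * θ) r x := by
        simpa using (hasDerivAt_id x).const_mul (r : ℂ)
      refine (h3.ccos.const_mul (2 / r * tpow ℓ (r / 2))).congr_deriv ?_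
      have h4 : (r : ℂ) * x = k * Real.pi := by rw [hx]; push_cast; field_simp
      rw [h4, Complex.sin_nat_mul_pi]
      simp
    have h5 := h1.unique h2
    rw [critPt, Complex.ofReal_cos]
    refine (mul_eq_zero.1 h5).resolve_right ?_
    refine mul_ne_zero (mul_ne_zero two_ne_zero (tpow_ne_zero _ _)) (neg_ne_zero.2 ?_)
    rw [hx, ← Complex.ofReal_sin]
    exact Complex.ofReal_ne_zero.2 hsk.ne'
  · have h1 : Tendsto θ atBot (𝓝 (j * Real.pi / r)) := by
      have h2 := (((Real.continuous_arctan.tendsto 0).comp Real.tendsto_exp_atBot).const_mul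
        (ε * (2 / r))).const_add (j * Real.pi / r : ℝ)
      rw [Real.arctan_zero, mul_zero, add_zero] at h2
      exact h2
    exact (hcos.tendsto _).comp (h1.comp ht.tendsto_atBot)
  · have h1 : Tendsto θ atTop (𝓝 (k * Real.pi / r)) := by
      have h2 := (((Real.tendsto_arctan_atTop.mono_right nhdsWithin_le_nhds).comp
        Real.tendsto_exp_atTop).const_mul (ε * (2 / r))).const_add (j * Real.pi / r : ℝ)
      rw [← hθ1] at h2
      exact h2
    exact (hcos.tendsto _).comp (h1.comp htop)

/-- If v is purely imaginary then v² < 0, and 2v² f(w_j) = -1 makes the critical value positive,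
which produces a Stokes line. -/
theorem re_thimbleScale_ne_zero {r j : ℕ} (hr : 3 ≤ r) (hj1 : 1 ≤ j) (hjr : j + 1 ≤ r) {ℓ : ℂ}
    (h : ¬ OnStokesRay r j ℓ) : (thimbleScale r j ℓ).re ≠ 0 := by
  intro h0
  apply h
  have hr0 : 0 < r := by omega
  have h1 : thimbleScale r j ℓ ^ 2 = ((-(thimbleScale r j ℓ).im ^ 2 : ℝ) : ℂ) := by
    apply Complex.ext <;> simp [pow_two, h0]
  have him : (thimbleScale r j ℓ).im ≠ 0 := fun h2 =>
    thimbleScale_ne_zero hr0 j ℓ (Complex.ext h0 h2)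
  set m := (thimbleScale r j ℓ).im
  have hpos : (-1) ^ j * (2 / r) * tpow ℓ (r / 2) = ((1 / (2 * m ^ 2) : ℝ) : ℂ) := by
    have h2 := thimbleScale_sq_mul hr0 j ℓ
    rw [h1] at h2
    have h3 : (m : ℂ) ≠ 0 := Complex.ofReal_ne_zero.2 him
    push_cast at h2 ⊢
    rw [eq_div_iff (by simp [h3])]
    linear_combination -h2
  -- The neighbour is j + 1 unless j = r - 1; then it is j - 1, which is at least 1 because r ≥ 3.
  rcases Nat.lt_or_ge (j + 1) r with hlt | hge
  · exact hasStokesLine_of_pos (k := j + 1) (ε := 1) hj1 hjr (by omega) hlt (by norm_num)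
      (by push_cast; ring) (by positivity) hpos
  · exact hasStokesLine_of_pos (k := j - 1) (ε := -1) hj1 hjr (by omega) (by omega) (by norm_num)
      (by rw [Nat.cast_sub hj1]; push_cast; ring) (by positivity) hpos

/-! ### The Airy-Lucas function -/

/-- The integrand along the thimble. -/
theorem integrand_thimbleCurve_mul_deriv {r : ℕ} (hr : 0 < r) (a j : ℕ) {ℓ : ℂ}
    (hv : (thimbleScale r j ℓ).re ≠ 0) (y : ℝ) :
    integrand r a ℓ (thimbleCurve r j ℓ y) * deriv (thimbleCurve r j ℓ) y =
      4 / r * tpow ℓ (1 / 2) ^ (a + 1) * thimbleScale r j ℓ *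
        Complex.exp ((-1) ^ j * (2 / r) * tpow ℓ (r / 2)) *
        (Complex.sinh (((a + 1) * j * Real.pi / r : ℝ) * Complex.I +
          (2 * (a + 1) / r : ℝ) * arsinh (thimbleScale r j ℓ * y)) /
          sqrtOneAddSq (thimbleScale r j ℓ * y) * Real.exp (-y ^ 2)) := by
  have h1 := lucasU_cosh_mul_sinh a (tpow ℓ (1 / 2)) (thimbleArg r j ℓ y)
  have h2 : ((a : ℂ) + 1) * thimbleArg r j ℓ y = ((a + 1) * j * Real.pi / r : ℝ) * Complex.I +
      (2 * (a + 1) / r : ℝ) * arsinh (thimbleScale r j ℓ * y) := by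
    rw [thimbleArg]; push_cast; ring
  rw [h2, tpow_half_sq] at h1
  rw [(hasDerivAt_thimbleCurve (mem_arsinh_domain_of_re_ne_zero hv y)).deriv, integrand,
    phase_thimbleCurve hr, phase_critPt hr.ne', sub_eq_add_neg, Complex.exp_add, thimbleCurve]
  push_cast at h1 ⊢
  generalize Complex.exp (-(y : ℂ) ^ 2) = e1
  generalize Complex.exp ((-1) ^ j * (2 / r) * tpow ℓ (r / 2)) = e2
  linear_combination (e2 * e1 * (4 / r) * tpow ℓ (1 / 2) * thimbleScale r j ℓ /
    sqrtOneAddSq (thimbleScale r j ℓ * y)) * h1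

theorem continuous_sinh_div_sqrtOneAddSq_ray (α : ℂ) (b : ℝ) {v : ℂ} (hv : v.re ≠ 0) :
    Continuous fun y : ℝ => Complex.sinh (α + b * arsinh (v * y)) / sqrtOneAddSq (v * y) := by
  refine continuous_iff_continuousAt.2 fun y => ?_
  have hm : ContinuousAt (fun y : ℝ => v * (y : ℂ)) y := by fun_prop
  have hy := mem_arsinh_domain_of_re_ne_zero hv y
  have h1 : ContinuousAt (fun y : ℝ => arsinh (v * y)) y :=
    ContinuousAt.comp (f := fun y : ℝ => v * (y : ℂ)) (hasDerivAt_arsinh hy).continuousAt hm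
  have h2 : ContinuousAt (fun y : ℝ => sqrtOneAddSq (v * y)) y :=
    ContinuousAt.comp (f := fun y : ℝ => v * (y : ℂ)) (hasDerivAt_sqrtOneAddSq hy).continuousAt hm
  refine ContinuousAt.div ?_ h2 (sqrtOneAddSq_ne_zero hy)
  exact Complex.continuous_sinh.continuousAt.comp (continuousAt_const.add (h1.const_mul _))

theorem integrable_sinh_div_sqrtOneAddSq_ray (α : ℂ) {b : ℝ} (hb : |b| ≤ 2) {v : ℂ}
    (hv : v.re ≠ 0) :
    Integrable fun y : ℝ => Complex.sinh (α + b * arsinh (v * y)) / sqrtOneAddSq (v * y) *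
      Real.exp (-y ^ 2) := by
  have hv0 : 0 < ‖v‖ := norm_pos_iff.2 (by rintro rfl; simp at hv)
  -- On a single ray this is the sharp constant in δ|x| ≤ |Re x|.
  set δ := |v.re| / ‖v‖ with hδ
  have hδ0 : 0 < δ := div_pos (abs_pos.2 hv) hv0
  have hδ1 : δ ≤ 1 := (div_le_one hv0).2 (Complex.abs_re_le_norm v)
  set K := 2 / δ * (‖Complex.sinh α‖ + ‖Complex.cosh α‖) with hK
  set g : ℝ → ℝ := fun y => K * (8 * ‖v‖ ^ 2 * (y ^ 2 * Real.exp (-y ^ 2)) +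
    2 * (y ^ 0 * Real.exp (-y ^ 2))) with hg
  have hgi : Integrable g := (((integrable_pow_mul_exp_neg_sq 2).const_mul _).add
    ((integrable_pow_mul_exp_neg_sq 0).const_mul _)).const_mul K
  refine hgi.mono' ((continuous_sinh_div_sqrtOneAddSq_ray α b hv).mul
    (by fun_prop)).aestronglyMeasurable (Eventually.of_forall fun y => ?_)
  have hx : δ * ‖v * y‖ ≤ |(v * y).re| := by
    rw [norm_mul, Complex.re_mul_ofReal, abs_mul, ← mul_assoc, hδ, div_mul_cancel₀ _ hv0.ne',
      Complex.norm_real, Real.norm_eq_abs]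
  have h1 := le_norm_sqrtOneAddSq hδ0.le hδ1 hx
  have h2 : ‖Complex.sinh (α + b * arsinh (v * y))‖ ≤
      (‖Complex.sinh α‖ + ‖Complex.cosh α‖) * (2 * ‖v * y‖ + 1) ^ 2 := by
    rw [Complex.sinh_add, add_mul]
    refine (norm_add_le _ _).trans ?_
    rw [norm_mul, norm_mul]
    gcongr
    · exact norm_cosh_mul_arsinh_le hb _
    · exact norm_sinh_mul_arsinh_le hb _
  have h3 : (2 * ‖v * y‖ + 1) ^ 2 ≤ 8 * ‖v‖ ^ 2 * y ^ 2 + 2 := by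
    have : ‖v * y‖ ^ 2 = ‖v‖ ^ 2 * y ^ 2 := by
      rw [norm_mul, mul_pow, Complex.norm_real, Real.norm_eq_abs, sq_abs]
    nlinarith [sq_nonneg (2 * ‖v * y‖ - 1)]
  rw [norm_mul, norm_div, Complex.norm_real, Real.norm_of_nonneg (Real.exp_pos _).le]
  calc _ ≤ (‖Complex.sinh α‖ + ‖Complex.cosh α‖) * (8 * ‖v‖ ^ 2 * y ^ 2 + 2) / (δ / 2) *
        Real.exp (-y ^ 2) := by
        gcongr
        exact h2.trans (by gcongr)
    _ = g y := by simp only [hg, hK]; field_simp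

theorem abs_two_mul_add_one_div_le {r a : ℕ} (hr : 3 ≤ r) (ha : a ≤ r - 2) :
    |(2 * (a + 1) / r : ℝ)| ≤ 2 := by
  have hr' : (0 : ℝ) < r := by exact_mod_cast (by omega : 0 < r)
  rw [abs_of_nonneg (by positivity), div_le_iff₀ hr']
  have : (a + 1 : ℝ) ≤ r := by exact_mod_cast (by omega : a + 1 ≤ r)
  linarith

/-- The thimble integral is a Gaussian average of `coshQuot`. -/
theorem thimble_integral_eq {r a j : ℕ} (hr : 3 ≤ r) (ha : a ≤ r - 2) (hj1 : 1 ≤ j)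
    (hjr : j + 1 ≤ r) {ℓ : ℂ} (hv : (thimbleScale r j ℓ).re ≠ 0) (Γ : Thimble r j ℓ) :
    Γ.Converges (integrand r a ℓ) ∧ Γ.integral (integrand r a ℓ) =
      8 / r * tpow ℓ (1 / 2) ^ (a + 1) * thimbleScale r j ℓ *
        Complex.exp ((-1) ^ j * (2 / r) * tpow ℓ (r / 2)) *
        (Real.sin ((a + 1) * j * Real.pi / r) * Complex.I) *
        ∫ y : ℝ in Set.Ioi 0,
          coshQuot (2 * (a + 1) / r) (thimbleScale r j ℓ * y) * Real.exp (-y ^ 2) := by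
  have hr0 : 0 < r := by omega
  have hcurve := isDescentCurve_thimbleCurve hj1 hjr hv
  have hint : Integrable fun y : ℝ =>
      integrand r a ℓ (thimbleCurve r j ℓ y) * deriv (thimbleCurve r j ℓ) y := by
    simp only [integrand_thimbleCurve_mul_deriv hr0 a j hv]
    exact (integrable_sinh_div_sqrtOneAddSq_ray _ (abs_two_mul_add_one_div_le hr ha) hv).const_mul _
  obtain ⟨hconv, heq⟩ := hcurve.integral_lefschetzThimble
    (unitVec_deriv_thimbleCurve_zero hj1 hjr ℓ) Γ (integrand r a ℓ) hint
  refine ⟨hconv, heq.trans ?_⟩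
  rw [← integral_const_mul]
  refine setIntegral_congr_fun measurableSet_Ioi fun y _ => ?_
  have h1 := integrand_thimbleCurve_mul_deriv hr0 a j hv y
  have h2 := integrand_thimbleCurve_mul_deriv hr0 a j hv (-y)
  -- Since arsinh is odd and √(1+x²) is even, the values at ±y add up through sinh(α+β) + sinh(α-β)
  -- = 2 sinh α cosh β.
  rw [h1, ← Complex.ofReal_neg, h2, Complex.ofReal_neg, mul_neg,
    arsinh_neg (mem_arsinh_domain_of_re_ne_zero hv y), sqrtOneAddSq_neg, neg_sq, mul_neg,
    ← sub_eq_add_neg, Complex.sinh_add, Complex.sinh_sub, Complex.sinh_mul_I, coshQuot,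
    Complex.ofReal_sin]
  ring

theorem nonempty_thimble {r j : ℕ} (hj1 : 1 ≤ j) (hjr : j + 1 ≤ r) {ℓ : ℂ}
    (hv : (thimbleScale r j ℓ).re ≠ 0) : Nonempty (Thimble r j ℓ) := by
  rw [Thimble, ← unitVec_deriv_thimbleCurve_zero hj1 hjr]
  exact (isDescentCurve_thimbleCurve hj1 hjr hv).nonempty_lefschetzThimble

/-- The Airy-Lucas function as a Gaussian average. -/
theorem Ai_eq {r a j : ℕ} (hr : 3 ≤ r) (ha : a ≤ r - 2) (hj1 : 1 ≤ j) (hjr : j + 1 ≤ r) {ℓ : ℂ}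
    (hv : (thimbleScale r j ℓ).re ≠ 0) :
    Ai r a j ℓ = Complex.exp ((-1) ^ j * (2 / r) * tpow ℓ (r / 2)) / (√(Real.pi * r) : ℂ) *
      (Real.sin ((a + 1) * j * Real.pi / r) : ℂ) * tpow ℓ ((2 * a + 2 - r) / 4) *
      (((2 / √Real.pi : ℝ) : ℂ) * ∫ y : ℝ in Set.Ioi 0,
        coshQuot (2 * (a + 1) / r) (thimbleScale r j ℓ * y) * Real.exp (-y ^ 2)) := by
  have hne := nonempty_thimble hj1 hjr hv
  have hr0 : (0 : ℝ) < r := by exact_mod_cast (by omega : 0 < r)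
  rw [Ai, dif_pos hne, (thimble_integral_eq hr ha hj1 hjr hv _).2]
  generalize (∫ y : ℝ in Set.Ioi 0,
        coshQuot (2 * (a + 1) / r) (thimbleScale r j ℓ * y) * Real.exp (-y ^ 2)) = J
  have h1 : ((√r : ℝ) : ℂ) ≠ 0 := by rw [Complex.ofReal_ne_zero]; positivity
  have h2 : ((√Real.pi : ℝ) : ℂ) ≠ 0 := by
    rw [Complex.ofReal_ne_zero]
    have := Real.pi_pos
    positivity
  have h3 : (r : ℂ) = ((√r : ℝ) : ℂ) ^ 2 := by
    rw [← Complex.ofReal_pow, Real.sq_sqrt (Nat.cast_nonneg r)]; simp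
  have h4 : (Real.pi : ℂ) = ((√Real.pi : ℝ) : ℂ) ^ 2 := by
    rw [← Complex.ofReal_pow, Real.sq_sqrt Real.pi_pos.le]
  have h5 : tpow ℓ ((2 * a + 2 - r) / 4) = tpow ℓ (1 / 2) ^ (a + 1) * tpow ℓ (-r / 4) := by
    rw [tpow_half_pow, ← tpow_add]; congr 1; push_cast; ring
  have h6 := sqrtSign_ne_zero j
  rw [h5, thimbleScale, Real.sqrt_mul Real.pi_pos.le]
  push_cast
  generalize Complex.exp ((-1) ^ j * (2 / r) * tpow ℓ (r / 2)) = e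
  generalize Complex.sin ((a + 1) * j * Real.pi / r) = s
  generalize tpow ℓ (1 / 2) ^ (a + 1) = x
  generalize tpow ℓ (-r / 4) = x'
  rw [show (8 / (r : ℂ)) = 8 / ((√r : ℝ) : ℂ) ^ 2 by rw [← h3],
    show (2 * (Real.pi : ℂ) * sqrtSign j) = 2 * ((√Real.pi : ℝ) : ℂ) ^ 2 * sqrtSign j by rw [← h4]]
  field_simp
  rw [Complex.I_sq]
  ring

/-- The Gaussian averages of the Taylor terms are the coefficients of the series `B`. -/
theorem gaussCoeff_mul_thimbleScale_pow {r : ℕ} (hr : 0 < r) (a j m : ℕ) (ℓ : ℂ) :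
    gaussCoeff (2 * (a + 1) / r) m * thimbleScale r j ℓ ^ (2 * m) =
      ((√Real.pi / 2 : ℝ) : ℂ) * (PowerSeries.coeff m (B r a) *
        ((-1) ^ (j + 1) * r * tpow ℓ (-r / 2)) ^ m) := by
  have hr' : (r : ℂ) ≠ 0 := by exact_mod_cast hr.ne'
  induction m with
  | zero => simp [gaussCoeff_zero, B]
  | succ m ih =>
    have h1 : (m + 1 : ℂ) ≠ 0 := by exact_mod_cast m.succ_ne_zero
    have h2 : PowerSeries.coeff (m + 1) (B r a) = PowerSeries.coeff m (B r a) *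
        (((2 * ((m + 1 : ℕ) : ℂ) - 1) * r - 2 * (a + 1)) *
          ((2 * ((m + 1 : ℕ) : ℂ) - 1) * r + 2 * (a + 1)) / ((m + 1 : ℕ) : ℂ) *
          (-1 / (16 * (r : ℂ) ^ 2))) := by
      rw [B, PowerSeries.coeff_mk, PowerSeries.coeff_mk,
        Finset.prod_Icc_succ_top (Nat.le_add_left 1 m), pow_succ]
      ring
    rw [gaussCoeff_succ, Nat.mul_succ, pow_add, thimbleScale_sq, h2, pow_succ]
    generalize (-1) ^ (j + 1) * r * tpow ℓ (-r / 2) = u at *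
    -- For b = 2(a+1)/r, r²((2m+1)² - b²) is the product of the two linear factors in `B` with k = m
    -- + 1.
    have h3 : gaussCoeff (2 * (a + 1) / r) m * thimbleScale r j ℓ ^ (2 * m) *
        (-((2 * m + 1) ^ 2 - ((2 * (a + 1) / r : ℝ) : ℂ) ^ 2) / (4 * (m + 1)) * (u / 4)) =
        ((√Real.pi / 2 : ℝ) : ℂ) * (PowerSeries.coeff m (B r a) * u ^ m) *
        (-((2 * m + 1) ^ 2 - ((2 * (a + 1) / r : ℝ) : ℂ) ^ 2) / (4 * (m + 1)) * (u / 4)) := by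
      rw [ih]
    refine (Eq.trans ?_ h3).trans ?_
    · ring
    · push_cast
      field_simp
      ring

/-! ### Sectors -/

/-- On a closed sector without Stokes rays the descent direction stays away from the branch cuts. -/
theorem exists_le_abs_re_thimbleScale {r j : ℕ} (hr : 3 ≤ r) (hj1 : 1 ≤ j) (hjr : j + 1 ≤ r)
    {α β : ℝ} (h : ∀ ℓ : ℂ, ℓ.im ∈ Set.Icc α β → ¬ OnStokesRay r j ℓ) :
    ∃ δ, 0 < δ ∧ δ ≤ 1 ∧ ∀ ℓ : ℂ, ℓ.im ∈ Set.Icc α β →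
      δ * ‖thimbleScale r j ℓ‖ ≤ |(thimbleScale r j ℓ).re| := by
  have hr0 : (0 : ℝ) < r := by exact_mod_cast (by omega : 0 < r)
  have hpos : 0 < √r / 2 := by positivity
  -- The phase of v depends only on the argument Im ℓ, so a continuous function on the compact
  -- interval [α, β] has to be bounded away from 0.
  set g : ℝ → ℂ := fun θ => -Complex.I * sqrtSign j * Complex.exp ((-r / 4 * θ : ℝ) * Complex.I)
    with hg
  have hgc : Continuous fun θ => |(g θ).re| := by
    simp only [hg]; fun_prop
  have hgn : ∀ θ, ‖g θ‖ = 1 := fun θ => by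
    simp only [hg, norm_mul, norm_neg, Complex.norm_I, norm_sqrtSign, Complex.norm_exp_ofReal_mul_I,
      one_mul]
  have hfac : ∀ ℓ : ℂ, thimbleScale r j ℓ =
      ((√r / 2 * Real.exp (-r / 4 * ℓ.re) : ℝ) : ℂ) * g ℓ.im := by
    intro ℓ
    have : tpow ℓ (-r / 4) = ((Real.exp (-r / 4 * ℓ.re) : ℝ) : ℂ) *
        Complex.exp ((-r / 4 * ℓ.im : ℝ) * Complex.I) := by
      rw [tpow, Complex.ofReal_exp, ← Complex.exp_add]
      congr 1
      nth_rewrite 1 [← Complex.re_add_im ℓ]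
      push_cast
      ring
    rw [thimbleScale, this]
    simp only [hg]
    push_cast
    ring
  have hg0 : ∀ θ ∈ Set.Icc α β, 0 < |(g θ).re| := by
    intro θ hθ
    have h1 := re_thimbleScale_ne_zero hr hj1 hjr (h (θ * Complex.I) (by simpa using hθ))
    rw [hfac, Complex.re_ofReal_mul] at h1
    have h2 := right_ne_zero_of_mul h1
    simpa using h2
  obtain ⟨δ, hδ0, hδ⟩ : ∃ δ, 0 < δ ∧ ∀ θ ∈ Set.Icc α β, δ ≤ |(g θ).re| := by
    rcases (Set.Icc α β).eq_empty_or_nonempty with he | hne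
    · exact ⟨1, one_pos, by simp [he]⟩
    · obtain ⟨θ₀, hθ₀, hmin⟩ := isCompact_Icc.exists_isMinOn hne hgc.continuousOn
      exact ⟨_, hg0 θ₀ hθ₀, fun θ hθ => hmin hθ⟩
  refine ⟨min δ 1, lt_min hδ0 one_pos, min_le_right _ _, fun ℓ hℓ => ?_⟩
  have hp : 0 < √r / 2 * Real.exp (-r / 4 * ℓ.re) := mul_pos hpos (Real.exp_pos _)
  rw [hfac, norm_mul, hgn, mul_one, Complex.norm_real, Real.norm_of_nonneg hp.le,
    Complex.re_ofReal_mul, abs_mul, abs_of_pos hp, mul_comm]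
  gcongr
  exact (min_le_left _ _).trans (hδ _ hℓ)

theorem norm_tpow_le_one {ℓ : ℂ} (hℓ : 0 ≤ ℓ.re) {s : ℝ} (hs : s ≤ 0) : ‖tpow ℓ s‖ ≤ 1 := by
  rw [tpow, Complex.norm_exp, Complex.re_ofReal_mul, Real.exp_le_one_iff]
  exact mul_nonpos_of_nonpos_of_nonneg hs hℓ

theorem norm_thimbleScale_sq (r j : ℕ) (ℓ : ℂ) :
    ‖thimbleScale r j ℓ‖ ^ 2 = r / 4 * ‖tpow ℓ (-r / 2)‖ := by
  rw [← norm_pow, thimbleScale_sq]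
  simp
  ring

/-- Here |v|² = (r/4)|t|^{-r/2} = (r/4)|t|^{1-r/2}|t|^{-1}, with |t|^{1-r/2} ≤ 1 because r ≥ 2 and
|t| ≥ 1. -/
theorem norm_thimbleScale_le_one {r : ℕ} (hr : 3 ≤ r) (j : ℕ) {ℓ : ℂ}
    (hℓ : (r : ℝ) ≤ ‖Complex.exp ℓ‖) : ‖thimbleScale r j ℓ‖ ≤ 1 := by
  have hr' : (3 : ℝ) ≤ r := by exact_mod_cast hr
  rw [← sq_le_one_iff₀ (norm_nonneg _), norm_thimbleScale_sq]
  have hre : 0 ≤ ℓ.re := by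
    rw [Complex.norm_exp] at hℓ
    exact Real.one_le_exp_iff.1 (by linarith)
  have h1 : tpow ℓ (-r / 2) = tpow ℓ ((1 - r / 2 : ℝ) : ℂ) * (Complex.exp ℓ)⁻¹ := by
    rw [tpow, tpow, ← Complex.exp_neg, ← Complex.exp_add]
    congr 1; push_cast; ring
  rw [h1, norm_mul, norm_inv]
  have h2 := norm_tpow_le_one hre (s := 1 - r / 2) (by linarith)
  have h3 : (r : ℝ) * ‖Complex.exp ℓ‖⁻¹ ≤ 1 := by
    rw [mul_inv_le_iff₀ (by linarith), one_mul]; exact hℓ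
  have h4 : 0 ≤ (r : ℝ) * ‖Complex.exp ℓ‖⁻¹ := by positivity
  calc r / 4 * (‖tpow ℓ ((1 - r / 2 : ℝ) : ℂ)‖ * ‖Complex.exp ℓ‖⁻¹)
      = (r * ‖Complex.exp ℓ‖⁻¹) * ‖tpow ℓ ((1 - r / 2 : ℝ) : ℂ)‖ / 4 := by ring
    _ ≤ 1 * 1 / 4 := by gcongr
    _ ≤ 1 := by norm_num

end AiryLucas

/-! ### The proposition -/

theorem proposition3p2 (r a j : ℕ) (hr : 3 ≤ r) (ha : a ≤ r - 2) (hj1 : 1 ≤ j)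
    (hjr : j ≤ r - 1) :
    -- away from the Stokes rays the Airy-Lucas function is well defined by the thimble integral
    (∀ ℓ : ℂ, ¬ AiryLucas.OnStokesRay r j ℓ →
      Nonempty (AiryLucas.Thimble r j ℓ) ∧
      ∀ Γ : AiryLucas.Thimble r j ℓ,
        Γ.Converges (AiryLucas.integrand r a ℓ) ∧
        AiryLucas.Ai r a j ℓ =
          1 / (2 * Real.pi * AiryLucas.sqrtSign j) *
            Γ.integral (AiryLucas.integrand r a ℓ)) ∧
    -- the asymptotic expansion, uniform in closed sectors free of Stokes rays
    (∀ α β : ℝ, (∀ ℓ : ℂ, ℓ.im ∈ Set.Icc α β → ¬ AiryLucas.OnStokesRay r j ℓ) →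
      ∀ N : ℕ, ∃ C R : ℝ, ∀ ℓ : ℂ, ℓ.im ∈ Set.Icc α β → R ≤ ‖Complex.exp ℓ‖ →
        ‖AiryLucas.Ai r a j ℓ -
            Complex.exp ((-1) ^ j * (2 / r) * AiryLucas.tpow ℓ (r / 2)) /
                (Real.sqrt (Real.pi * r) : ℂ) *
              (Real.sin ((a + 1) * j * Real.pi / r) : ℂ) *
              AiryLucas.tpow ℓ ((2 * a + 2 - r) / 4) *
              ∑ m ∈ Finset.range N, PowerSeries.coeff m (AiryLucas.B r a) *
                ((-1) ^ (j + 1) * r * AiryLucas.tpow ℓ (-r / 2)) ^ m‖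
          ≤ C * ‖Complex.exp ((-1) ^ j * (2 / r) * AiryLucas.tpow ℓ (r / 2)) *
                AiryLucas.tpow ℓ ((2 * a + 2 - r) / 4)‖ *
              ‖AiryLucas.tpow ℓ (-r / 2)‖ ^ N) := by
  have hjr' : j + 1 ≤ r := by omega
  have hr0 : 0 < r := by omega
  refine ⟨fun ℓ hℓ => ?_, fun α β hαβ N => ?_⟩
  · have hv := AiryLucas.re_thimbleScale_ne_zero hr hj1 hjr' hℓ
    have hne := AiryLucas.nonempty_thimble hj1 hjr' hv
    refine ⟨hne, fun Γ => ⟨(AiryLucas.thimble_integral_eq hr ha hj1 hjr' hv Γ).1, ?_⟩⟩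
    -- `Ai` is defined through a chosen thimble, but the closed form of the integral is the same for
    -- all of them.
    rw [AiryLucas.Ai, dif_pos hne, (AiryLucas.thimble_integral_eq hr ha hj1 hjr' hv Γ).2,
      (AiryLucas.thimble_integral_eq hr ha hj1 hjr' hv _).2]
  · obtain ⟨δ, hδ0, hδ1, hδ⟩ := AiryLucas.exists_le_abs_re_thimbleScale hr hj1 hjr' hαβ
    obtain ⟨C, hC0, hC⟩ := AiryLucas.exists_norm_gaussAverage_sub_le
      (AiryLucas.abs_two_mul_add_one_div_le hr ha) N hδ0 hδ1
    -- The factor 2/√π normalises the half-line Gaussian, (r/4)^N comes from |v|^{2N} = (r/4)^N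
    -- |t^{-r/2}|^N, and |t| ≥ r ensures |v| ≤ 1.
    refine ⟨1 / √(Real.pi * r) * (2 / √Real.pi) * (C * (r / 4) ^ N), r, fun ℓ hℓ hR => ?_⟩
    have hv := AiryLucas.re_thimbleScale_ne_zero hr hj1 hjr' (hαβ ℓ hℓ)
    have hmain := hC _ hv (AiryLucas.norm_thimbleScale_le_one hr j hR) (hδ ℓ hℓ)
    simp only [AiryLucas.gaussCoeff_mul_thimbleScale_pow hr0] at hmain
    rw [← Finset.mul_sum, pow_mul, AiryLucas.norm_thimbleScale_sq, mul_pow] at hmain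
    rw [AiryLucas.Ai_eq hr ha hj1 hjr' hv, ← mul_sub]
    generalize (∫ y : ℝ in Set.Ioi 0, AiryLucas.coshQuot (2 * (a + 1) / r)
      (AiryLucas.thimbleScale r j ℓ * y) * Real.exp (-y ^ 2)) = J at *
    generalize (∑ m ∈ Finset.range N, PowerSeries.coeff m (AiryLucas.B r a) *
      ((-1) ^ (j + 1) * r * AiryLucas.tpow ℓ (-r / 2)) ^ m) = S at *
    have hpi : ((√Real.pi : ℝ) : ℂ) ≠ 0 := by
      rw [Complex.ofReal_ne_zero]
      have := Real.pi_pos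
      positivity
    have hJS : ((2 / √Real.pi : ℝ) : ℂ) * J - S =
        ((2 / √Real.pi : ℝ) : ℂ) * (J - ((√Real.pi / 2 : ℝ) : ℂ) * S) := by
      push_cast
      field_simp
    -- The error bound carries no sine factor, so the sine is estimated by 1.
    have hsin : ‖((Real.sin ((a + 1) * j * Real.pi / r) : ℝ) : ℂ)‖ ≤ 1 := by
      rw [Complex.norm_real]; exact Real.abs_sin_le_one _
    rw [hJS, norm_mul, norm_mul, norm_mul, norm_div, norm_mul (((2 / √Real.pi : ℝ) : ℂ)),
      norm_mul, Complex.norm_real (√(Real.pi * r)), Complex.norm_real (2 / √Real.pi),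
      Real.norm_of_nonneg (by positivity), Real.norm_of_nonneg (by positivity)]
    have he := norm_nonneg (Complex.exp ((-1) ^ j * (2 / r) * AiryLucas.tpow ℓ (r / 2)))
    generalize ‖Complex.exp ((-1) ^ j * (2 / r) * AiryLucas.tpow ℓ (r / 2))‖ = e at *
    calc _ ≤ e / √(Real.pi * r) * 1 * ‖AiryLucas.tpow ℓ ((2 * a + 2 - r) / 4)‖ *
          (2 / √Real.pi * (C * ((r / 4) ^ N * ‖AiryLucas.tpow ℓ (-r / 2)‖ ^ N))) := by gcongr
      _ = _ := by ring
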